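/- Let $d\ge 2$ and let $\Lambda\subset\mathbb Z^d$ be a non-empty finite set with $0\notin\Lambda$ that is invariant under all coordinate permutations and all sign changes of coordinates (symmetric), and which contains some $\lambda$ with $\lambda_1\ne\pm\lambda_2$ and $\lambda_1,\lambda_2\ne 0$ (non-degenerate). Let $\mathcal N=\#\Lambda$, let $\Lambda/\pm\subset\Lambda$ be any set of representatives of $\Lambda$ modulo $\lambda\mapsto-\lambda$, and consider the random function on the torus $\mathbb T^d=\mathbb R^d/\mathbb Z^d$ (of total measure $1$) $$f(x)=\sqrt{\frac{2}{\mathcal N}}\sum_{\lambda\in\Lambda/\pm}\bigl(b_\lambda\cos 2\pi\langle\lambda,x\rangle-c_\lambda\sin 2\pi\langle\lambda,x\rangle\bigr),$$ where $b_\lambda,c_\lambda$ ($\lambda\in\Lambda/\pm$) are independent standard Gaussian variables. Its two-point function is $\mathbb E(f(x)f(y))=u(x-y)$, where $$u(z)=\frac1{\mathcal N}\sum_{\lambda\in\Lambda}\cos 2\pi\langle\lambda,z\rangle .$$ The Leray measure of the nodal set of $f$, $$\mathcal L=\mathcal L(f)=\lim_{\epsilon\to0^+}\frac1{2\epsilon}\operatorname{meas}\{x\in\mathbb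 T^d:|f(x)|<\epsilon\},$$ exists as a finite limit almost surely and is square integrable, the kernel $1/\sqrt{1-u(z)^2}$ is integrable on $\mathbb T^d$, and $$\mathbb E(\mathcal L^2)=\frac1{2\pi}\int_{\mathbb T^d}\frac{dz}{\sqrt{1-u(z)^2}} .$$ -/

import Mathlib

open MeasureTheory ProbabilityTheory Filter Topology

noncomputable section

namespace LerayTorus

/-- A finite set `Λ ⊂ ℤ^d` is symmetric if it is non-empty, does not contain `0`, and is invariant
under the signed permutations of the coordinates. -/
structure IsSymmetric {d : ℕ} (Λ : Finset (Fin d → ℤ)) : Prop where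
  nonempty : Λ.Nonempty
  zero_notMem : (0 : Fin d → ℤ) ∉ Λ
  perm_mem : ∀ (σ : Equiv.Perm (Fin d)), ∀ l ∈ Λ, (fun i => l (σ i)) ∈ Λ
  sign_mem : ∀ (s : Fin d → ℤˣ), ∀ l ∈ Λ, (fun i => (s i : ℤ) * l i) ∈ Λ

/-- Some `l ∈ Λ` has non-zero first and second coordinates with `l₁ ≠ ± l₂`. -/
def IsNondegenerate {d : ℕ} (hd : 2 ≤ d) (Λ : Finset (Fin d → ℤ)) : Prop :=
  ∃ l ∈ Λ, l ⟨0, by omega⟩ ≠ l ⟨1, by omega⟩ ∧ l ⟨0, by omega⟩ ≠ -l ⟨1, by omega⟩ ∧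
    l ⟨0, by omega⟩ ≠ 0 ∧ l ⟨1, by omega⟩ ≠ 0

/-- `R` is a set of representatives of `Λ/±`: it contains exactly one of `l`, `-l` for every
`l ∈ Λ`. -/
def IsRepresentatives {d : ℕ} (Λ R : Finset (Fin d → ℤ)) : Prop :=
  R ⊆ Λ ∧ ∀ l ∈ Λ, Xor (l ∈ R) (-l ∈ R)

/-- The function `cos 2π⟨l, x⟩` on the torus `ℝ^d/ℤ^d`, the real part of `exp(2πi⟨l, x⟩)`. -/
def cosMode {d : ℕ} (l : Fin d → ℤ) (x : UnitAddTorus (Fin d)) : ℝ :=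
  (UnitAddTorus.mFourier l x).re

/-- The function `sin 2π⟨l, x⟩` on the torus, the imaginary part of `exp(2πi⟨l, x⟩)`. -/
def sinMode {d : ℕ} (l : Fin d → ℤ) (x : UnitAddTorus (Fin d)) : ℝ :=
  (UnitAddTorus.mFourier l x).im

theorem mFourier_coe {d : ℕ} (l : Fin d → ℤ) (x : Fin d → ℝ) :
    UnitAddTorus.mFourier l (fun i => (x i : UnitAddCircle)) =
      Complex.exp (((2 * Real.pi * ∑ i, (l i : ℝ) * x i : ℝ) : ℂ) * Complex.I) := by
  simp only [UnitAddTorus.mFourier, ContinuousMap.coe_mk, fourier_coe_apply, ← Complex.exp_sum]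
  congr 1
  push_cast
  rw [Finset.mul_sum, Finset.sum_mul]
  refine Finset.sum_congr rfl fun i _ => ?_
  simp only [div_one]
  ring

theorem cosMode_coe {d : ℕ} (l : Fin d → ℤ) (x : Fin d → ℝ) :
    cosMode l (fun i => (x i : UnitAddCircle)) =
      Real.cos (2 * Real.pi * ∑ i, (l i : ℝ) * x i) := by
  rw [cosMode, mFourier_coe, Complex.exp_ofReal_mul_I_re]

theorem sinMode_coe {d : ℕ} (l : Fin d → ℤ) (x : Fin d → ℝ) :
    sinMode l (fun i => (x i : UnitAddCircle)) =
      Real.sin (2 * Real.pi * ∑ i, (l i : ℝ) * x i) := by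
  rw [sinMode, mFourier_coe, Complex.exp_ofReal_mul_I_im]

/-- Coordinates `(b_l, c_l)`, `l ∈ Λ/±`, of the space spanned by the exponentials with frequencies
in `Λ`. -/
abbrev Coeff {d : ℕ} (R : Finset (Fin d → ℤ)) : Type := {l // l ∈ R} → ℝ × ℝ

/-- The Gaussian probability measure under which all `b_l` and `c_l`, `l ∈ Λ/±`, are independent
standard normal variables. -/
def gaussianEnsemble {d : ℕ} (R : Finset (Fin d → ℤ)) : Measure (Coeff R) :=
  Measure.pi fun _ => (gaussianReal 0 1).prod (gaussianReal 0 1)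

/-- The random function
`f(x) = √(2/𝒩) ∑_{l ∈ Λ/±} (b_l cos 2π⟨l, x⟩ - c_l sin 2π⟨l, x⟩)`, where `𝒩 = #Λ`. -/
def randomFunction {d : ℕ} (Λ R : Finset (Fin d → ℤ)) (Z : Coeff R)
    (x : UnitAddTorus (Fin d)) : ℝ :=
  Real.sqrt (2 / (Λ.card : ℝ)) *
    ∑ l : {l // l ∈ R}, ((Z l).1 * cosMode l.1 x - (Z l).2 * sinMode l.1 x)

/-- `(1/2ε) meas {x : |f(x)| < ε}`; the torus has total measure `1`. -/
def lerayApprox {d : ℕ} (f : UnitAddTorus (Fin d) → ℝ) (ε : ℝ) : ℝ :=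
  1 / (2 * ε) * (volume : Measure (UnitAddTorus (Fin d))).real {x | |f x| < ε}

/-- The Leray measure of the nodal set of `f`: the limit of `(1/2ε) meas {x : |f(x)| < ε}` as
`ε → 0+` (of meaning only where this limit exists). -/
def leray {d : ℕ} (f : UnitAddTorus (Fin d) → ℝ) : ℝ :=
  limUnder (𝓝[>] (0 : ℝ)) (lerayApprox f)

/-- The two-point function `u(z) = (1/𝒩) ∑_{l ∈ Λ} cos 2π⟨l, z⟩`. -/
def twoPoint {d : ℕ} (Λ : Finset (Fin d → ℤ)) (z : UnitAddTorus (Fin d)) : ℝ :=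
  1 / (Λ.card : ℝ) * ∑ l ∈ Λ, cosMode l z

end LerayTorus

end

namespace LerayTorus

/-! ### Linear functionals of the Gaussian ensemble -/

section Ensemble

variable {d : ℕ} (R : Finset (Fin d → ℤ))

/-! Write `L_ε` for `lerayApprox` at scale `ε`. By Fubini, `E(L_ε L_δ)` is the integral over pairs
`(x, y)` of `P(|f(x)| < ε, |f(y)| < δ) / (4εδ)`. The pair `(f(x), f(y))` is Gaussian with unit
variances and covariance `u = u(x - y)`. When `|u| < 1` its density at the origin is `1 / (2π√(1 -
u²))`; this value bounds the normalised probability for all `ε, δ`, and is its limit as `ε, δ → 0`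
(`smallBall_bounds`, `tendsto_smallBall`). If the kernel is integrable, dominated convergence gives
`E(L_ε L_δ) → I`, the asserted second moment. Expanding `E(L_ε - L_δ)²` shows that `L_ε` is Cauchy
in mean square along `ε = 1/(n+1)`, with limit of squared norm `I`; an almost sure limit must
coincide with it (`memLp_and_integral_sq_of_tendsto`).

Two inputs remain. For the kernel (`twoPoint_kernel`), `1 - u` dominates a multiple of the sum of `1
- cos 2π⟨l, z⟩` over two independent frequencies. The two phases are independent and uniform on the
circle, and AM-GM splits the inverse square root into a product of integrable functions of one phase
each. A half-period shift treats `1 + u` in the same way.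

Almost sure existence of the limit (`ae_exists_tendsto_lerayApprox`) needs no regularity of the
nodal set. With all coefficients but one frozen, `f = h + b g` with `g` a multiple of one cosine or
sine. Where `g` is bounded away from `0`, `|f| < ε` means `|g| |H - b| < ε` with `H = -h/g`, so the
limit is a weighted derivative at `b` of the distribution of `H`. It exists for almost every `b` by
differentiation of measures (`ae_exists_tendsto_weighted`). The cosine and the sine of one frequency
together cover the torus. -/

instance isProbabilityMeasure_gaussianEnsemble : IsProbabilityMeasure (gaussianEnsemble R) := by
  unfold gaussianEnsemble; infer_instance

instance isGaussian_gaussianEnsemble : IsGaussian (gaussianEnsemble R) := by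
  have h := iIndepFun.hasGaussianLaw (P := gaussianEnsemble R)
    (X := fun (l : {l // l ∈ R}) (Z : Coeff R) => Z l)
    (fun l => ⟨by
      rw [gaussianEnsemble, (measurePreserving_eval _ l).map_eq]
      infer_instance⟩)
    (iIndepFun_pi (X := fun _ => id) fun _ => aemeasurable_id)
  simpa using h.isGaussian_map

/-- The linear functional of the coefficients with coordinates `a`. -/
noncomputable def linearFunctional {R : Finset (Fin d → ℤ)} (a : Coeff R) : Coeff R →L[ℝ] ℝ :=
  ∑ l, ((a l).1 • (ContinuousLinearMap.fst ℝ ℝ ℝ).comp (ContinuousLinearMap.proj l) +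
    (a l).2 • (ContinuousLinearMap.snd ℝ ℝ ℝ).comp (ContinuousLinearMap.proj l))

variable {R}

theorem linearFunctional_apply (a Z : Coeff R) :
    linearFunctional a Z = ∑ l, ((a l).1 * (Z l).1 + (a l).2 * (Z l).2) := by
  simp [linearFunctional]

theorem linearFunctional_add (a b : Coeff R) :
    linearFunctional (a + b) = linearFunctional a + linearFunctional b := by
  ext Z
  simp only [linearFunctional_apply, add_apply, ← Finset.sum_add_distrib,
    Pi.add_apply, Prod.fst_add, Prod.snd_add]
  exact Finset.sum_congr rfl fun l _ => by ring

theorem memLp_linearFunctional (a : Coeff R) :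
    MemLp (fun Z => linearFunctional a Z) 2 (gaussianEnsemble R) :=
  IsGaussian.memLp_dual _ _ 2 (by simp)

theorem memLp_planar (s t : ℝ) :
    MemLp (fun z : ℝ × ℝ => s * z.1 + t * z.2) 2 ((gaussianReal 0 1).prod (gaussianReal 0 1)) := by
  exact IsGaussian.memLp_dual ((gaussianReal 0 1).prod (gaussianReal 0 1))
    (s • ContinuousLinearMap.fst ℝ ℝ ℝ + t • ContinuousLinearMap.snd ℝ ℝ ℝ) 2 (by simp)

theorem integral_planar (s t : ℝ) :
    ∫ z : ℝ × ℝ, (s * z.1 + t * z.2) ∂((gaussianReal 0 1).prod (gaussianReal 0 1)) = 0 := by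
  have h : Integrable (fun x : ℝ => x) (gaussianReal 0 1) :=
    (memLp_id_gaussianReal 1).integrable le_rfl
  rw [integral_add ((h.comp_fst _).const_mul s) ((h.comp_snd _).const_mul t),
    integral_const_mul, integral_const_mul, integral_fun_fst (fun x : ℝ => x),
    integral_fun_snd (fun x : ℝ => x)]
  simp

theorem variance_planar (s t : ℝ) :
    Var[fun z : ℝ × ℝ => s * z.1 + t * z.2; (gaussianReal 0 1).prod (gaussianReal 0 1)] =
      s ^ 2 + t ^ 2 := by
  have h : MemLp (fun x : ℝ => x) 2 (gaussianReal 0 1) := memLp_id_gaussianReal 2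
  rw [variance_add_prod (h.const_mul s) (h.const_mul t), variance_const_mul, variance_const_mul,
    variance_fun_id_gaussianReal]
  simp

theorem integral_linearFunctional (a : Coeff R) :
    ∫ Z, linearFunctional a Z ∂(gaussianEnsemble R) = 0 := by
  simp only [linearFunctional_apply]
  rw [integral_finsetSum]
  · refine Finset.sum_eq_zero fun l _ => ?_
    rw [gaussianEnsemble, integral_comp_eval
      (μ := fun _ : {l // l ∈ R} => (gaussianReal 0 1).prod (gaussianReal 0 1))
      (f := fun z : ℝ × ℝ => (a l).1 * z.1 + (a l).2 * z.2)
      (memLp_planar _ _).aestronglyMeasurable, integral_planar]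
  · intro l _
    exact integrable_comp_eval
      (μ := fun _ : {l // l ∈ R} => (gaussianReal 0 1).prod (gaussianReal 0 1))
      (f := fun z : ℝ × ℝ => (a l).1 * z.1 + (a l).2 * z.2)
      ((memLp_planar _ _).integrable one_le_two)

theorem integral_linearFunctional_sq (a : Coeff R) :
    ∫ Z, linearFunctional a Z ^ 2 ∂(gaussianEnsemble R) = ∑ l, ((a l).1 ^ 2 + (a l).2 ^ 2) := by
  rw [← variance_of_integral_eq_zero (memLp_linearFunctional a).aestronglyMeasurable.aemeasurable
    (integral_linearFunctional a)]
  have h := variance_sum_pi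
    (μ := fun _ : {l // l ∈ R} => (gaussianReal 0 1).prod (gaussianReal 0 1))
    (X := fun l z => (a l).1 * z.1 + (a l).2 * z.2) fun l => memLp_planar _ _
  simp only [variance_planar] at h
  rw [← h, gaussianEnsemble]
  congr 1
  ext Z
  simp [linearFunctional_apply]

theorem integrable_linearFunctional_mul (a b : Coeff R) :
    Integrable (fun Z => linearFunctional a Z * linearFunctional b Z) (gaussianEnsemble R) :=
  (memLp_linearFunctional a).integrable_mul (memLp_linearFunctional b)

/-- Polarisation of `integral_linearFunctional_sq` at `a + b`. -/
theorem integral_linearFunctional_mul (a b : Coeff R) :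
    ∫ Z, linearFunctional a Z * linearFunctional b Z ∂(gaussianEnsemble R) =
      ∑ l, ((a l).1 * (b l).1 + (a l).2 * (b l).2) := by
  have h := integral_linearFunctional_sq (a + b)
  have e : ∀ Z, linearFunctional (a + b) Z ^ 2 = linearFunctional a Z ^ 2 +
      2 * (linearFunctional a Z * linearFunctional b Z) + linearFunctional b Z ^ 2 := fun Z => by
    rw [linearFunctional_add, add_apply]; ring
  simp only [e] at h
  have ha := (memLp_linearFunctional a).integrable_sq
  have hb := (memLp_linearFunctional b).integrable_sq
  have hab := (integrable_linearFunctional_mul a b).const_mul 2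
  rw [integral_add (by exact ha.add hab) hb, integral_add ha hab, integral_const_mul,
    integral_linearFunctional_sq, integral_linearFunctional_sq] at h
  have e' : ∑ l, (((a + b) l).1 ^ 2 + ((a + b) l).2 ^ 2) = ∑ l, ((a l).1 ^ 2 + (a l).2 ^ 2) +
      2 * ∑ l, ((a l).1 * (b l).1 + (a l).2 * (b l).2) + ∑ l, ((b l).1 ^ 2 + (b l).2 ^ 2) := by
    rw [Finset.mul_sum, ← Finset.sum_add_distrib, ← Finset.sum_add_distrib]
    refine Finset.sum_congr rfl fun l _ => ?_
    simp only [Pi.add_apply, Prod.fst_add, Prod.snd_add]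
    ring
  linarith

end Ensemble

/-! ### The two-point function -/

section TwoPoint

variable {d : ℕ}

theorem mFourier_add_apply (l : Fin d → ℤ) (x y : UnitAddTorus (Fin d)) :
    UnitAddTorus.mFourier l (x + y) = UnitAddTorus.mFourier l x * UnitAddTorus.mFourier l y := by
  simp [UnitAddTorus.mFourier, Finset.prod_mul_distrib, smul_add, AddCircle.toCircle_add]

theorem mFourier_neg_apply (l : Fin d → ℤ) (x : UnitAddTorus (Fin d)) :
    UnitAddTorus.mFourier l (-x) = (starRingEnd ℂ) (UnitAddTorus.mFourier l x) := by
  rw [← UnitAddTorus.mFourier_neg]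
  simp [UnitAddTorus.mFourier]

theorem cosMode_neg (l : Fin d → ℤ) (x : UnitAddTorus (Fin d)) :
    cosMode (-l) x = cosMode l x := by
  simp [cosMode, UnitAddTorus.mFourier_neg]

theorem cosMode_sub (l : Fin d → ℤ) (x y : UnitAddTorus (Fin d)) :
    cosMode l (x - y) = cosMode l x * cosMode l y + sinMode l x * sinMode l y := by
  simp only [cosMode, sinMode]
  rw [sub_eq_add_neg, mFourier_add_apply, mFourier_neg_apply]
  simp

theorem continuous_cosMode (l : Fin d → ℤ) : Continuous (cosMode l) :=
  Complex.continuous_re.comp (UnitAddTorus.mFourier l).continuous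

theorem continuous_sinMode (l : Fin d → ℤ) : Continuous (sinMode l) :=
  Complex.continuous_im.comp (UnitAddTorus.mFourier l).continuous

theorem continuous_twoPoint (Λ : Finset (Fin d → ℤ)) : Continuous (twoPoint Λ) :=
  continuous_const.mul (continuous_finsetSum _ fun l _ => continuous_cosMode l)

theorem cosMode_zero (l : Fin d → ℤ) : cosMode l 0 = 1 := by
  simp [cosMode, UnitAddTorus.mFourier]

theorem cosMode_sq_add_sinMode_sq (l : Fin d → ℤ) (x : UnitAddTorus (Fin d)) :
    cosMode l x ^ 2 + sinMode l x ^ 2 = 1 := by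
  have h := cosMode_sub l x x
  rw [sub_self, cosMode_zero] at h
  linarith

theorem twoPoint_zero {Λ : Finset (Fin d → ℤ)} (h : Λ.Nonempty) : twoPoint Λ 0 = 1 := by
  have : (Λ.card : ℝ) ≠ 0 := by simpa using h.ne_empty
  simp [twoPoint, cosMode_zero, this]

/-- The complement of `R` in `Λ` is exactly `-R`, so an even summand contributes equally on both
halves. -/
theorem IsRepresentatives.sum_eq {Λ R : Finset (Fin d → ℤ)} (hR : IsRepresentatives Λ R)
    (hneg : ∀ l ∈ Λ, -l ∈ Λ) {g : (Fin d → ℤ) → ℝ} (hg : ∀ l, g (-l) = g l) :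
    ∑ l ∈ Λ, g l = 2 * ∑ l ∈ R, g l := by
  classical
  have e : Λ \ R = R.image Neg.neg := by
    ext l
    simp only [Finset.mem_sdiff, Finset.mem_image]
    constructor
    · rintro ⟨h1, h2⟩
      exact ⟨-l, by have := hR.2 l h1; simp_all [Xor], neg_neg l⟩
    · rintro ⟨m, hm, rfl⟩
      refine ⟨hneg m (hR.1 hm), ?_⟩
      have := hR.2 m (hR.1 hm)
      simp_all [Xor]
  rw [← Finset.sum_sdiff hR.1, e, Finset.sum_image (fun _ _ _ _ h => neg_injective h)]
  simp only [hg]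
  ring

theorem IsSymmetric.neg_mem {Λ : Finset (Fin d → ℤ)} (h : IsSymmetric Λ) :
    ∀ l ∈ Λ, -l ∈ Λ := fun l hl => by
  have := h.sign_mem (fun _ => -1) l hl
  convert! this using 1
  ext i
  simp

/-- The coordinates of the evaluation functional `f ↦ f(x)`. -/
noncomputable def evaluationCoeff (Λ R : Finset (Fin d → ℤ)) (x : UnitAddTorus (Fin d)) : Coeff R :=
  fun l => (Real.sqrt (2 / (Λ.card : ℝ)) * cosMode l.1 x,
    -(Real.sqrt (2 / (Λ.card : ℝ)) * sinMode l.1 x))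

theorem randomFunction_eq (Λ R : Finset (Fin d → ℤ)) (Z : Coeff R) (x : UnitAddTorus (Fin d)) :
    randomFunction Λ R Z x = linearFunctional (evaluationCoeff Λ R x) Z := by
  rw [randomFunction, linearFunctional_apply, Finset.mul_sum]
  refine Finset.sum_congr rfl fun l _ => ?_
  simp only [evaluationCoeff]
  ring

theorem integral_randomFunction_mul {Λ R : Finset (Fin d → ℤ)} (hneg : ∀ l ∈ Λ, -l ∈ Λ)
    (hR : IsRepresentatives Λ R) (x y : UnitAddTorus (Fin d)) :
    ∫ Z, randomFunction Λ R Z x * randomFunction Λ R Z y ∂(gaussianEnsemble R) =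
      twoPoint Λ (x - y) := by
  simp only [randomFunction_eq]
  rw [integral_linearFunctional_mul, twoPoint, hR.sum_eq hneg fun l => cosMode_neg l _]
  have hs : Real.sqrt (2 / (Λ.card : ℝ)) * Real.sqrt (2 / (Λ.card : ℝ)) = 2 / Λ.card :=
    Real.mul_self_sqrt (by positivity)
  have : ∀ l : {l // l ∈ R}, (evaluationCoeff Λ R x l).1 * (evaluationCoeff Λ R y l).1 +
      (evaluationCoeff Λ R x l).2 * (evaluationCoeff Λ R y l).2 =
      2 / (Λ.card : ℝ) * cosMode l.1 (x - y) := fun l => by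
    rw [← hs, cosMode_sub]
    simp only [evaluationCoeff]
    ring
  rw [Finset.sum_congr rfl fun l _ => this l, ← Finset.mul_sum,
    Finset.sum_coe_sort R fun l => cosMode l (x - y)]
  ring

end TwoPoint

/-! ### Small ball probabilities of a pair of Gaussian variables -/

section SmallBall

open scoped NNReal ENNReal

theorem variance_linearFunctional_comb {d : ℕ} {R : Finset (Fin d → ℤ)} (a b : Coeff R) (s t : ℝ) :
    Var[fun Z => s * linearFunctional a Z + t * linearFunctional b Z; gaussianEnsemble R] =
      s ^ 2 * ∫ Z, linearFunctional a Z * linearFunctional a Z ∂(gaussianEnsemble R) +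
      2 * s * t * ∫ Z, linearFunctional a Z * linearFunctional b Z ∂(gaussianEnsemble R) +
      t ^ 2 * ∫ Z, linearFunctional b Z * linearFunctional b Z ∂(gaussianEnsemble R) := by
  have ha := (memLp_linearFunctional a).const_mul s
  have hb := (memLp_linearFunctional b).const_mul t
  have hm : ∫ Z, (s * linearFunctional a Z + t * linearFunctional b Z) ∂(gaussianEnsemble R) = 0 := by
    rw [integral_add (ha.integrable one_le_two) (hb.integrable one_le_two), integral_const_mul,
      integral_const_mul, integral_linearFunctional, integral_linearFunctional]
    simp
  rw [variance_of_integral_eq_zero (by exact (ha.add hb).aestronglyMeasurable.aemeasurable) hm,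
    ← integral_const_mul, ← integral_const_mul, ← integral_const_mul]
  have h1 := (integrable_linearFunctional_mul a a).const_mul (s ^ 2)
  have h2 := (integrable_linearFunctional_mul a b).const_mul (2 * s * t)
  have h3 := (integrable_linearFunctional_mul b b).const_mul (t ^ 2)
  rw [← integral_add h1 h2, ← integral_add (by exact h1.add h2) h3]
  congr 1
  ext Z
  ring

/-- Two normalised linear functionals of the ensemble with covariance `u` have the joint law of
`(ξ, u ξ + s η)`, where `ξ`, `η` are independent standard normal variables. -/
theorem map_linearFunctional_pair {d : ℕ} {R : Finset (Fin d → ℤ)} (a b : Coeff R) {u s : ℝ}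
    (hs : u ^ 2 + s ^ 2 = 1)
    (haa : ∫ Z, linearFunctional a Z * linearFunctional a Z ∂(gaussianEnsemble R) = 1)
    (hab : ∫ Z, linearFunctional a Z * linearFunctional b Z ∂(gaussianEnsemble R) = u)
    (hbb : ∫ Z, linearFunctional b Z * linearFunctional b Z ∂(gaussianEnsemble R) = 1) :
    (gaussianEnsemble R).map (fun Z => (linearFunctional a Z, linearFunctional b Z)) =
      ((gaussianReal 0 1).prod (gaussianReal 0 1)).map (fun z => (z.1, u * z.1 + s * z.2)) := by
  have hm1 : Measurable fun Z : Coeff R => (linearFunctional a Z, linearFunctional b Z) := by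
    fun_prop
  have hm2 : Measurable fun z : ℝ × ℝ => (z.1, u * z.1 + s * z.2) := by fun_prop
  have i1 : IsGaussian ((gaussianEnsemble R).map
      fun Z => (linearFunctional a Z, linearFunctional b Z)) :=
    isGaussian_map (μ := gaussianEnsemble R) ((linearFunctional a).prod (linearFunctional b))
  have i2 : IsGaussian (((gaussianReal 0 1).prod (gaussianReal 0 1)).map
      fun z : ℝ × ℝ => (z.1, u * z.1 + s * z.2)) :=
    isGaussian_map (μ := (gaussianReal 0 1).prod (gaussianReal 0 1))
      ((ContinuousLinearMap.fst ℝ ℝ ℝ).prod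
        (u • ContinuousLinearMap.fst ℝ ℝ ℝ + s • ContinuousLinearMap.snd ℝ ℝ ℝ))
  -- Both laws are Gaussian, so it suffices to match the mean and variance of each functional `L =
  -- p·fst + q·snd`. The means vanish and both variances are `p² + 2pqu + q²`.
  refine Measure.ext_of_charFunDual ?_
  ext L
  have hL : ∀ p : ℝ × ℝ, L p = L (1, 0) * p.1 + L (0, 1) * p.2 := fun p => by
    have : p = p.1 • ((1, 0) : ℝ × ℝ) + p.2 • ((0, 1) : ℝ × ℝ) := by ext <;> simp
    conv_lhs => rw [this]
    rw [map_add, map_smul, map_smul, smul_eq_mul, smul_eq_mul]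
    ring
  have hLm : Continuous L := L.continuous
  rw [IsGaussian.charFunDual_eq, IsGaussian.charFunDual_eq,
    integral_complex_ofReal, integral_complex_ofReal,
    integral_map hm1.aemeasurable hLm.aestronglyMeasurable,
    integral_map hm2.aemeasurable hLm.aestronglyMeasurable,
    variance_map hLm.aemeasurable hm1.aemeasurable, variance_map hLm.aemeasurable hm2.aemeasurable]
  set p := L (1, 0)
  set q := L (0, 1)
  have e1 : ∫ Z, L (linearFunctional a Z, linearFunctional b Z) ∂(gaussianEnsemble R) = 0 := by
    simp only [hL]
    rw [integral_add (((memLp_linearFunctional a).const_mul p).integrable one_le_two)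
      (((memLp_linearFunctional b).const_mul q).integrable one_le_two), integral_const_mul,
      integral_const_mul, integral_linearFunctional, integral_linearFunctional]
    simp
  have k : ∀ z : ℝ × ℝ, L (z.1, u * z.1 + s * z.2) = (p + q * u) * z.1 + (q * s) * z.2 :=
    fun z => by rw [hL]; ring
  have e2 : ∫ z : ℝ × ℝ, L (z.1, u * z.1 + s * z.2)
      ∂((gaussianReal 0 1).prod (gaussianReal 0 1)) = 0 := by
    simp only [k]
    exact integral_planar _ _
  have e3 : Var[L ∘ fun Z => (linearFunctional a Z, linearFunctional b Z); gaussianEnsemble R] =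
      p ^ 2 + 2 * p * q * u + q ^ 2 := by
    have : (L ∘ fun Z => (linearFunctional a Z, linearFunctional b Z)) =
        fun Z => p * linearFunctional a Z + q * linearFunctional b Z := by
      ext Z; simp only [Function.comp, hL]
    rw [this, variance_linearFunctional_comb, haa, hab, hbb]
    ring
  have e4 : Var[L ∘ fun z : ℝ × ℝ => (z.1, u * z.1 + s * z.2);
      (gaussianReal 0 1).prod (gaussianReal 0 1)] = p ^ 2 + 2 * p * q * u + q ^ 2 := by
    have : (L ∘ fun z : ℝ × ℝ => (z.1, u * z.1 + s * z.2)) =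
        fun z => (p + q * u) * z.1 + (q * s) * z.2 := by
      ext z; exact k z
    rw [this, variance_planar]
    linear_combination q ^ 2 * hs
  rw [e1, e2, e3, e4]

theorem volume_abs_lt (ε : ℝ) : volume {y : ℝ | |y| < ε} = ENNReal.ofReal (2 * ε) := by
  have : {y : ℝ | |y| < ε} = Set.Ioo (-ε) ε := by ext y; simp [abs_lt]
  rw [this, Real.volume_Ioo]
  congr 1
  ring

theorem measurableSet_abs_lt (ε : ℝ) : MeasurableSet {y : ℝ | |y| < ε} :=
  measurableSet_lt measurable_norm measurable_const

/-- The density never exceeds its value at the mean. -/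
theorem gaussianReal_abs_lt_le (m ε : ℝ) {v : ℝ≥0} (hv : v ≠ 0) :
    gaussianReal m v {y | |y| < ε} ≤ ENNReal.ofReal ((√(2 * Real.pi * v))⁻¹ * (2 * ε)) := by
  rw [gaussianReal_apply m hv, ENNReal.ofReal_mul (by positivity), ← volume_abs_lt,
    ← setLIntegral_const]
  refine lintegral_mono fun x => ENNReal.ofReal_le_ofReal ?_
  rw [gaussianPDFReal_def]
  refine mul_le_of_le_one_right (by positivity) (Real.exp_le_one_iff.2 ?_)
  exact div_nonpos_of_nonpos_of_nonneg (by nlinarith [sq_nonneg (x - m)]) (by positivity)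

/-- Points of the interval lie within `M + ε` of the mean, which bounds the density from below. -/
theorem le_gaussianReal_abs_lt {m M : ℝ} (ε : ℝ) (hm : |m| ≤ M) {v : ℝ≥0} (hv : v ≠ 0) :
    ENNReal.ofReal ((√(2 * Real.pi * v))⁻¹ * Real.exp (-(M + ε) ^ 2 / (2 * v)) * (2 * ε)) ≤
      gaussianReal m v {y | |y| < ε} := by
  rw [gaussianReal_apply m hv, ENNReal.ofReal_mul (by positivity), ← volume_abs_lt,
    ← setLIntegral_const]
  refine setLIntegral_mono (measurable_gaussianPDF m v) fun x hx =>
    ENNReal.ofReal_le_ofReal ?_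
  rw [gaussianPDFReal_def]
  have hx' : |x - m| ≤ M + ε := by
    have := abs_sub x m
    simp only [Set.mem_ofPred_eq] at hx
    linarith
  have : (x - m) ^ 2 ≤ (M + ε) ^ 2 := by
    rw [← sq_abs]
    exact pow_le_pow_left₀ (abs_nonneg _) hx' 2
  exact mul_le_mul_of_nonneg_left (Real.exp_le_exp.2
    (div_le_div_of_nonneg_right (neg_le_neg this) (by positivity))) (by positivity)

/-- Conditioning on the first variable: given `ξ = x`, the second is normal with mean `u x` and
variance `s²`. -/
theorem measure_linearFunctional_pair_eq {d : ℕ} {R : Finset (Fin d → ℤ)} (a b : Coeff R) {u s : ℝ}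
    (hs : u ^ 2 + s ^ 2 = 1)
    (haa : ∫ Z, linearFunctional a Z * linearFunctional a Z ∂(gaussianEnsemble R) = 1)
    (hab : ∫ Z, linearFunctional a Z * linearFunctional b Z ∂(gaussianEnsemble R) = u)
    (hbb : ∫ Z, linearFunctional b Z * linearFunctional b Z ∂(gaussianEnsemble R) = 1)
    (ε δ : ℝ) :
    gaussianEnsemble R {Z | |linearFunctional a Z| < ε ∧ |linearFunctional b Z| < δ} =
      ∫⁻ x in {x | |x| < ε}, gaussianReal (u * x) (NNReal.mk (s ^ 2) (sq_nonneg s)) {y | |y| < δ}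
        ∂(gaussianReal 0 1) := by
  have hS := (measurableSet_abs_lt ε).prod (measurableSet_abs_lt δ)
  have hm2 : Measurable fun z : ℝ × ℝ => (z.1, u * z.1 + s * z.2) := by fun_prop
  have h := congrArg (fun μ => μ ({y : ℝ | |y| < ε} ×ˢ {y : ℝ | |y| < δ}))
    (map_linearFunctional_pair a b hs haa hab hbb)
  rw [Measure.map_apply (by fun_prop) hS, Measure.map_apply hm2 hS,
    Measure.prod_apply (hm2 hS)] at h
  refine Eq.trans h ?_
  rw [← lintegral_indicator (measurableSet_abs_lt ε)]
  refine lintegral_congr fun x => ?_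
  have hmap : (gaussianReal 0 1).map (fun y => u * x + s * y) =
      gaussianReal (u * x) (NNReal.mk (s ^ 2) (sq_nonneg s)) := by
    have : (fun y => u * x + s * y) = (fun y => u * x + y) ∘ fun y => s * y := rfl
    rw [this, ← Measure.map_map (by fun_prop) (by fun_prop), gaussianReal_map_const_mul,
      gaussianReal_map_const_add]
    simp
  by_cases hx : |x| < ε
  · rw [Set.indicator_of_mem (by exact hx), ← hmap,
      Measure.map_apply (by fun_prop) (measurableSet_abs_lt δ)]
    congr 1
    ext y
    simp [hx]
  · rw [Set.indicator_of_notMem (by exact hx)]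
    convert! measure_empty (μ := gaussianReal 0 1)
    ext y
    simp [hx]

theorem measure_linearFunctional_pair_le {d : ℕ} {R : Finset (Fin d → ℤ)} (a b : Coeff R)
    {u s : ℝ} (hs0 : 0 < s) (hs : u ^ 2 + s ^ 2 = 1)
    (haa : ∫ Z, linearFunctional a Z * linearFunctional a Z ∂(gaussianEnsemble R) = 1)
    (hab : ∫ Z, linearFunctional a Z * linearFunctional b Z ∂(gaussianEnsemble R) = u)
    (hbb : ∫ Z, linearFunctional b Z * linearFunctional b Z ∂(gaussianEnsemble R) = 1)
    {ε δ : ℝ} (hε : 0 < ε) (hδ : 0 < δ) :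
    (gaussianEnsemble R).real {Z | |linearFunctional a Z| < ε ∧ |linearFunctional b Z| < δ} ≤
      4 * ε * δ * (1 / (2 * Real.pi) * (1 / s)) := by
  refine ENNReal.toReal_le_of_le_ofReal (by positivity) ?_
  rw [measure_linearFunctional_pair_eq a b hs haa hab hbb]
  have hv : NNReal.mk (s ^ 2) (sq_nonneg s) ≠ 0 := by
    rw [Ne, ← NNReal.coe_eq_zero]; exact pow_ne_zero 2 hs0.ne'
  refine (lintegral_mono fun x => gaussianReal_abs_lt_le (u * x) δ hv).trans ?_
  rw [setLIntegral_const]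
  refine (mul_le_mul_right (gaussianReal_abs_lt_le 0 ε one_ne_zero) _).trans ?_
  rw [← ENNReal.ofReal_mul (by positivity)]
  refine ENNReal.ofReal_le_ofReal (le_of_eq ?_)
  have e1 : √(2 * Real.pi * ((NNReal.mk (s ^ 2) (sq_nonneg s) : ℝ≥0) : ℝ)) = √(2 * Real.pi) * s := by
    rw [NNReal.coe_mk, Real.sqrt_mul (by positivity), Real.sqrt_sq hs0.le]
  have e2 : √(2 * Real.pi * ((1 : ℝ≥0) : ℝ)) = √(2 * Real.pi) := by simp
  have e3 : √(2 * Real.pi) ^ 2 = 2 * Real.pi := Real.sq_sqrt (by positivity)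
  have e4 : √(2 * Real.pi) ≠ 0 := by positivity
  have e5 : 1 / (2 * Real.pi) = (√(2 * Real.pi))⁻¹ ^ 2 := by rw [inv_pow, e3, one_div]
  rw [e1, e2, e5]
  field_simp
  norm_num

/-- Matches the upper bound up to a factor tending to `1` as `ε, δ → 0` for fixed `s`. The
conditional mean satisfies `|u x| ≤ ε`, whence `ε + δ`; the first variable is centred, whence `0 +
ε`. -/
theorem le_measure_linearFunctional_pair {d : ℕ} {R : Finset (Fin d → ℤ)} (a b : Coeff R)
    {u s : ℝ} (hs0 : 0 < s) (hs : u ^ 2 + s ^ 2 = 1)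
    (haa : ∫ Z, linearFunctional a Z * linearFunctional a Z ∂(gaussianEnsemble R) = 1)
    (hab : ∫ Z, linearFunctional a Z * linearFunctional b Z ∂(gaussianEnsemble R) = u)
    (hbb : ∫ Z, linearFunctional b Z * linearFunctional b Z ∂(gaussianEnsemble R) = 1)
    {ε δ : ℝ} (hε : 0 < ε) (hδ : 0 < δ) :
    4 * ε * δ * (1 / (2 * Real.pi) * (1 / s)) *
        (Real.exp (-(0 + ε) ^ 2 / 2) * Real.exp (-(ε + δ) ^ 2 / (2 * s ^ 2))) ≤
      (gaussianEnsemble R).real {Z | |linearFunctional a Z| < ε ∧ |linearFunctional b Z| < δ} := by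
  refine (ENNReal.ofReal_le_iff_le_toReal (measure_ne_top _ _)).1 ?_
  rw [measure_linearFunctional_pair_eq a b hs haa hab hbb]
  have hv : NNReal.mk (s ^ 2) (sq_nonneg s) ≠ 0 := by
    rw [Ne, ← NNReal.coe_eq_zero]; exact pow_ne_zero 2 hs0.ne'
  have hu : |u| ≤ 1 := abs_le_one_iff_mul_self_le_one.2 (by nlinarith [sq_nonneg s])
  have hux : ∀ x ∈ {x : ℝ | |x| < ε}, |u * x| ≤ ε := fun x hx => by
    rw [abs_mul]
    exact (mul_le_of_le_one_left (abs_nonneg x) hu).trans (le_of_lt hx)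
  refine le_trans ?_ (setLIntegral_mono' (measurableSet_abs_lt ε) fun x hx =>
    le_gaussianReal_abs_lt δ (hux x hx) hv)
  rw [setLIntegral_const]
  refine le_trans ?_ (mul_le_mul_right
    (le_gaussianReal_abs_lt (m := 0) (M := 0) ε (by simp) one_ne_zero) _)
  rw [← ENNReal.ofReal_mul (by positivity)]
  refine ENNReal.ofReal_le_ofReal (le_of_eq ?_)
  have e1 : √(2 * Real.pi * ((NNReal.mk (s ^ 2) (sq_nonneg s) : ℝ≥0) : ℝ)) = √(2 * Real.pi) * s := by
    rw [NNReal.coe_mk, Real.sqrt_mul (by positivity), Real.sqrt_sq hs0.le]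
  have e2 : √(2 * Real.pi * ((1 : ℝ≥0) : ℝ)) = √(2 * Real.pi) := by simp
  have e3 : √(2 * Real.pi) ^ 2 = 2 * Real.pi := Real.sq_sqrt (by positivity)
  have e4 : √(2 * Real.pi) ≠ 0 := by positivity
  have e5 : 1 / (2 * Real.pi) = (√(2 * Real.pi))⁻¹ ^ 2 := by rw [inv_pow, e3, one_div]
  rw [e1, e2, e5]
  simp only [NNReal.coe_mk, NNReal.coe_one, mul_one]
  field_simp
  norm_num

end SmallBall

/-! ### Integrability of the kernel -/

section Kernel

/-- The function `1 - cos 2πs` on the circle. -/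
noncomputable def versine (s : UnitAddCircle) : ℝ := 1 - (fourier 1 s : ℂ).re

theorem continuous_versine : Continuous versine :=
  continuous_const.sub (Complex.continuous_re.comp (fourier (T := (1 : ℝ)) 1).continuous)

theorem versine_coe (x : ℝ) : versine (x : UnitAddCircle) = 1 - Real.cos (2 * Real.pi * x) := by
  have : (2 * Real.pi * Complex.I * ((1 : ℤ) : ℂ) * x / ((1 : ℝ) : ℂ)) =
      ((2 * Real.pi * x : ℝ) : ℂ) * Complex.I := by
    push_cast; ring
  rw [versine, fourier_coe_apply, this, Complex.exp_ofReal_mul_I_re]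

theorem versine_nonneg (s : UnitAddCircle) : 0 ≤ versine s := by
  induction s using QuotientAddGroup.induction_on with
  | H x => exact (versine_coe x).symm ▸ sub_nonneg.2 (Real.cos_le_one _)

/-- The bound `cos y ≤ 1 - 2y²/π²` for `|y| ≤ π`, taken at `y = 2πx`; hence `8 = (2/π²)(2π)²`. -/
theorem sq_le_versine {x : ℝ} (hx : |x| ≤ 1 / 2) : 8 * x ^ 2 ≤ versine (x : UnitAddCircle) := by
  rw [versine_coe]
  have h := Real.cos_le_one_sub_mul_cos_sq (x := 2 * Real.pi * x) (by
    rw [abs_mul, abs_of_pos Real.two_pi_pos]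
    nlinarith [Real.pi_pos])
  have : 2 / Real.pi ^ 2 * (2 * Real.pi * x) ^ 2 = 8 * x ^ 2 := by
    field_simp
    ring
  linarith

theorem measurePreserving_coe_circle :
    MeasurePreserving ((↑) : ℝ → UnitAddCircle) (volume.restrict (Set.Ioc (-(1 / 2)) (1 / 2))) := by
  have := UnitAddCircle.measurePreserving_mk (-(1 / 2))
  norm_num at this ⊢
  exact this

theorem ae_versine_pos : ∀ᵐ s : UnitAddCircle, 0 < versine s := by
  have hm := measurePreserving_coe_circle
  rw [← hm.map_eq, ae_map_iff hm.aemeasurable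
    (measurableSet_lt measurable_const continuous_versine.measurable)]
  filter_upwards [ae_restrict_mem measurableSet_Ioc, ae_restrict_of_ae (Measure.ae_ne volume (0 : ℝ))] with x hx h0
  have := sq_le_versine (x := x) (abs_le.2 ⟨hx.1.le, hx.2⟩)
  have h2 : 0 < x ^ 2 := by positivity
  linarith

/-- The exponent is the one AM-GM leaves to each of two phases. The function is at most
`|x|^(-1/2)`, which is integrable, whereas the power `-1/2` would behave like `1/|x|`. -/
theorem integrable_versine_rpow : Integrable fun s : UnitAddCircle => versine s ^ (-(1 / 4) : ℝ) := by
  have hm := measurePreserving_coe_circle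
  have hmeas : Measurable fun s : UnitAddCircle => versine s ^ (-(1 / 4) : ℝ) :=
    continuous_versine.measurable.pow_const _
  rw [← hm.map_eq, integrable_map_measure hmeas.aestronglyMeasurable hm.aemeasurable]
  have h1 : IntegrableOn (fun x : ℝ => |x| ^ (-(1 / 2) : ℝ)) (Set.Ioc (-(1 / 2)) (1 / 2)) := by
    refine (intervalIntegrable_iff_integrableOn_Ioc_of_le (by norm_num)).1
      (intervalIntegrable_of_even (fun x => by rw [abs_neg]) fun x hx => ?_)
    refine (intervalIntegral.intervalIntegrable_rpow' (r := -(1 / 2)) (by norm_num)).congr fun y hy => ?_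
    rw [Set.uIoc_of_le hx.le] at hy
    simp only [abs_of_pos hy.1]
  refine Integrable.mono' h1 (hmeas.comp hm.measurable).aestronglyMeasurable ?_
  filter_upwards [ae_restrict_mem measurableSet_Ioc, ae_restrict_of_ae (Measure.ae_ne volume (0 : ℝ))] with x hx h0
  have h := sq_le_versine (x := x) (abs_le.2 ⟨hx.1.le, hx.2⟩)
  have h2 : 0 < x ^ 2 := by positivity
  rw [Function.comp, Real.norm_of_nonneg (Real.rpow_nonneg (versine_nonneg _) _)]
  have h3 : |x| ^ (-(1 / 2) : ℝ) = (x ^ 2) ^ (-(1 / 4) : ℝ) := by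
    rw [← sq_abs, ← Real.rpow_natCast, ← Real.rpow_mul (abs_nonneg x)]
    norm_num
  rw [h3]
  exact Real.rpow_le_rpow_of_nonpos h2 (by linarith) (by norm_num)

variable {d : ℕ}

/-- The character `z ↦ ⟨l, z⟩` of the torus, with values in the circle. -/
def pairing (l : Fin d → ℤ) : UnitAddTorus (Fin d) →+ UnitAddCircle where
  toFun z := ∑ i, l i • z i
  map_zero' := by simp
  map_add' x y := by simp [smul_add, Finset.sum_add_distrib]

theorem pairing_apply (l : Fin d → ℤ) (z : UnitAddTorus (Fin d)) :
    pairing l z = ∑ i, l i • z i := rfl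

theorem continuous_pairing (l : Fin d → ℤ) : Continuous (pairing l) := by
  change Continuous fun z : UnitAddTorus (Fin d) => ∑ i, l i • z i
  fun_prop

theorem fourier_pairing (l : Fin d → ℤ) (z : UnitAddTorus (Fin d)) :
    (fourier 1 (pairing l z) : ℂ) = UnitAddTorus.mFourier l z := by
  have h : ∀ s : Finset (Fin d), AddCircle.toCircle (∑ i ∈ s, l i • z i) =
      ∏ i ∈ s, AddCircle.toCircle (l i • z i) := fun s => by
    classical
    induction s using Finset.induction_on with
    | empty => simp
    | insert i s hi ih => rw [Finset.sum_insert hi, Finset.prod_insert hi, AddCircle.toCircle_add, ih]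
  rw [fourier_one, pairing_apply, h]
  simp only [UnitAddTorus.mFourier, ContinuousMap.coe_mk, fourier_apply]
  exact map_prod Circle.coeHom _ _

theorem versine_pairing (l : Fin d → ℤ) (z : UnitAddTorus (Fin d)) :
    versine (pairing l z) = 1 - cosMode l z := by
  rw [versine, fourier_pairing, cosMode]

theorem versine_add_half (s : UnitAddCircle) :
    versine (s + ((1 / 2 : ℝ) : UnitAddCircle)) = 2 - versine s := by
  induction s using QuotientAddGroup.induction_on with
  | H x =>
    rw [← AddCircle.coe_add, versine_coe, versine_coe, mul_add,
      show 2 * Real.pi * (1 / 2) = Real.pi by ring, Real.cos_add_pi]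
    ring

/-- Lift the target to `ℝ²` and solve by Cramer's rule with a point supported on the coordinates `i`
and `j`. -/
theorem pairing_prod_surjective {l m : Fin d → ℤ} {i j : Fin d}
    (h : l i * m j - l j * m i ≠ 0) :
    Function.Surjective ((pairing l).prod (pairing m)) := by
  rintro ⟨s, t⟩
  induction s using QuotientAddGroup.induction_on with
  | H x =>
  induction t using QuotientAddGroup.induction_on with
  | H y =>
  have hD : (l i * m j - l j * m i : ℝ) ≠ 0 := by exact_mod_cast h
  have hp : ∀ (k : Fin d → ℤ) (a b : ℝ),
      pairing k (Pi.single i (a : UnitAddCircle) + Pi.single j (b : UnitAddCircle)) =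
        ((k i * a + k j * b : ℝ) : UnitAddCircle) := fun k a b => by
    have hs : ∀ (i : Fin d) (c : UnitAddCircle),
        ∑ r, k r • (Pi.single i c : Fin d → UnitAddCircle) r = k i • c := fun i c => by
      rw [Finset.sum_eq_single i]
      · simp
      · intro r _ hr; simp [hr]
      · simp
    rw [map_add, pairing_apply, pairing_apply, hs, hs, ← AddCircle.coe_zsmul,
      ← AddCircle.coe_zsmul, ← AddCircle.coe_add, zsmul_eq_mul, zsmul_eq_mul]
  refine ⟨Pi.single i (((x * m j - y * l j) / (l i * m j - l j * m i) : ℝ) : UnitAddCircle) +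
    Pi.single j (((y * l i - x * m i) / (l i * m j - l j * m i) : ℝ) : UnitAddCircle), ?_⟩
  rw [AddMonoidHom.prod_apply, hp, hp]
  refine Prod.ext ?_ ?_
  · change ((_ : ℝ) : UnitAddCircle) = ((_ : ℝ) : UnitAddCircle)
    congr 1
    rw [mul_div_assoc', mul_div_assoc', ← add_div, div_eq_iff hD]
    ring
  · change ((_ : ℝ) : UnitAddCircle) = ((_ : ℝ) : UnitAddCircle)
    congr 1
    rw [mul_div_assoc', mul_div_assoc', ← add_div, div_eq_iff hD]
    ring

/-- A continuous surjective homomorphism of compact groups carries Haar measure to Haar measure once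
the total masses agree. -/
theorem measurePreserving_pairing_prod {l m : Fin d → ℤ} {i j : Fin d}
    (h : l i * m j - l j * m i ≠ 0) :
    MeasurePreserving (fun z : UnitAddTorus (Fin d) => (pairing l z, pairing m z))
      volume (volume.prod volume) := by
  refine AddMonoidHom.measurePreserving (f := (pairing l).prod (pairing m))
    ((continuous_pairing l).prodMk (continuous_pairing m)) (pairing_prod_surjective h) ?_
  rw [← Set.univ_prod_univ, Measure.prod_prod, volume_pi, Measure.pi_univ]
  simp

/-- AM-GM in the form `a + b ≥ 2√a√b`, followed by taking the power `-1/2`. -/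
theorem inv_sqrt_le_of_versine {C h a b : ℝ} (hC : 0 < C) (ha : 0 < a) (hb : 0 < b)
    (hh : C * (a + b) ≤ h) :
    1 / √h ≤ (2 * C) ^ (-(1 / 2) : ℝ) * (a ^ (-(1 / 4) : ℝ) * b ^ (-(1 / 4) : ℝ)) := by
  have h1 : 2 * C * (√a * √b) ≤ h := by
    have := sq_nonneg (√a - √b)
    have e1 := Real.sq_sqrt ha.le
    have e2 := Real.sq_sqrt hb.le
    nlinarith
  have hpos : 0 < 2 * C * (√a * √b) := by positivity
  have e : ∀ c : ℝ, 0 ≤ c → (√c) ^ (-(1 / 2) : ℝ) = c ^ (-(1 / 4) : ℝ) := fun c hc => by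
    rw [Real.sqrt_eq_rpow, ← Real.rpow_mul hc]
    norm_num
  rw [one_div, Real.sqrt_eq_rpow, ← Real.rpow_neg (hpos.le.trans h1), ← e a ha.le, ← e b hb.le,
    ← Real.mul_rpow (by positivity) (by positivity), ← Real.mul_rpow (by positivity) (by positivity)]
  exact Real.rpow_le_rpow_of_nonpos hpos h1 (by norm_num)

/-- Covers both factors of `1 - u²`: the shift `c` is `0` for `1 - u` and `1/2` for `1 + u`. -/
theorem integrable_inv_sqrt_of_versine_le {l m : Fin d → ℤ} {i j : Fin d}
    (hlm : l i * m j - l j * m i ≠ 0) (c : UnitAddCircle) {C : ℝ} (hC : 0 < C)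
    {h : UnitAddTorus (Fin d) → ℝ} (hm : Measurable h)
    (hh : ∀ z, C * (versine (pairing l z + c) + versine (pairing m z + c)) ≤ h z) :
    (∀ᵐ z, 0 < h z) ∧ Integrable fun z => 1 / √(h z) := by
  have hp := measurePreserving_pairing_prod hlm
  have hshift : MeasurePreserving (fun s : UnitAddCircle => s + c) volume volume :=
    measurePreserving_add_right volume c
  have hae : ∀ᵐ s : UnitAddCircle, 0 < versine (s + c) :=
    hshift.quasiMeasurePreserving.ae (p := fun s => 0 < versine s) ae_versine_pos
  have hint : Integrable fun s : UnitAddCircle => versine (s + c) ^ (-(1 / 4) : ℝ) :=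
    hshift.integrable_comp_of_integrable (g := fun s => versine s ^ (-(1 / 4) : ℝ)) integrable_versine_rpow
  have h1 : ∀ᵐ z : UnitAddTorus (Fin d), 0 < versine (pairing l z + c) :=
    (Measure.quasiMeasurePreserving_fst.comp hp.quasiMeasurePreserving).ae
      (p := fun s => 0 < versine (s + c)) hae
  have h2 : ∀ᵐ z : UnitAddTorus (Fin d), 0 < versine (pairing m z + c) :=
    (Measure.quasiMeasurePreserving_snd.comp hp.quasiMeasurePreserving).ae
      (p := fun s => 0 < versine (s + c)) hae
  refine ⟨?_, ?_⟩
  · filter_upwards [h1, h2] with z hz1 hz2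
    exact lt_of_lt_of_le (by positivity) (hh z)
  · have hI : Integrable fun z : UnitAddTorus (Fin d) =>
        versine (pairing l z + c) ^ (-(1 / 4) : ℝ) * versine (pairing m z + c) ^ (-(1 / 4) : ℝ) :=
      hp.integrable_comp_of_integrable (g := fun p : UnitAddCircle × UnitAddCircle =>
        versine (p.1 + c) ^ (-(1 / 4) : ℝ) * versine (p.2 + c) ^ (-(1 / 4) : ℝ))
        (hint.mul_prod hint)
    refine Integrable.mono' (hI.const_mul ((2 * C) ^ (-(1 / 2) : ℝ)))
      (measurable_const.div hm.sqrt).aestronglyMeasurable ?_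
    filter_upwards [h1, h2] with z hz1 hz2
    rw [Real.norm_of_nonneg (by positivity)]
    exact inv_sqrt_le_of_versine hC hz1 hz2 (hh z)

/-- For `u ≥ 0` the factor `1 + u` is at least `1`, and for `u ≤ 0` the factor `1 - u` is, so only
one factor can be small. -/
theorem inv_sqrt_one_sub_sq_le {u : ℝ} (h1 : 0 < 1 - u) (h2 : 0 < 1 + u) :
    1 / √(1 - u ^ 2) ≤ 1 / √(1 - u) + 1 / √(1 + u) := by
  rcases le_total 0 u with hu | hu
  · have : 1 / √(1 - u ^ 2) ≤ 1 / √(1 - u) :=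
      one_div_le_one_div_of_le (Real.sqrt_pos.2 h1) (Real.sqrt_le_sqrt (by nlinarith))
    have : 0 ≤ 1 / √(1 + u) := by positivity
    linarith
  · have : 1 / √(1 - u ^ 2) ≤ 1 / √(1 + u) :=
      one_div_le_one_div_of_le (Real.sqrt_pos.2 h2) (Real.sqrt_le_sqrt (by nlinarith))
    have : 0 ≤ 1 / √(1 - u) := by positivity
    linarith

/-- Both `1 - u` and `1 + u` are averages over `Λ` of non-negative terms, of which only those of `l`
and `m` are kept. -/
theorem twoPoint_kernel_of_mem {Λ : Finset (Fin d → ℤ)} {l m : Fin d → ℤ} (hl : l ∈ Λ) (hm : m ∈ Λ)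
    {i j : Fin d} (hlm : l i * m j - l j * m i ≠ 0) :
    (∀ᵐ z : UnitAddTorus (Fin d), 0 < 1 - twoPoint Λ z ∧ 0 < 1 + twoPoint Λ z) ∧
      Integrable fun z : UnitAddTorus (Fin d) => 1 / √(1 - twoPoint Λ z ^ 2) := by
  classical
  have hne : l ≠ m := by
    rintro rfl
    exact hlm (by ring)
  have hN : (0 : ℝ) < Λ.card := by exact_mod_cast Finset.card_pos.2 ⟨l, hl⟩
  have hsub : ({l, m} : Finset (Fin d → ℤ)) ⊆ Λ := by
    simp [Finset.insert_subset_iff, hl, hm]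
  have hmeas := (continuous_twoPoint Λ).measurable
  have key : ∀ g : (Fin d → ℤ) → ℝ, (∀ l, 0 ≤ g l) →
      1 / (Λ.card : ℝ) * (g l + g m) ≤ 1 / (Λ.card : ℝ) * ∑ k ∈ Λ, g k := fun g hg => by
    rw [← Finset.sum_pair hne]
    exact mul_le_mul_of_nonneg_left
      (Finset.sum_le_sum_of_subset_of_nonneg hsub fun k _ _ => hg k) (by positivity)
  have e1 : ∀ z, 1 / (Λ.card : ℝ) * ∑ k ∈ Λ, (1 - cosMode k z) = 1 - twoPoint Λ z := fun z => by
    rw [Finset.sum_sub_distrib, twoPoint, Finset.sum_const, nsmul_eq_mul]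
    field_simp
  have e2 : ∀ z, 1 / (Λ.card : ℝ) * ∑ k ∈ Λ, (1 + cosMode k z) = 1 + twoPoint Λ z := fun z => by
    rw [Finset.sum_add_distrib, twoPoint, Finset.sum_const, nsmul_eq_mul]
    field_simp
  have v1 : ∀ k (z : UnitAddTorus (Fin d)), versine (pairing k z + 0) = 1 - cosMode k z :=
    fun k z => by rw [add_zero, versine_pairing]
  have v2 : ∀ k (z : UnitAddTorus (Fin d)),
      versine (pairing k z + ((1 / 2 : ℝ) : UnitAddCircle)) = 1 + cosMode k z :=
    fun k z => by rw [versine_add_half, versine_pairing]; ring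
  obtain ⟨p1, i1⟩ := integrable_inv_sqrt_of_versine_le hlm 0 (C := 1 / (Λ.card : ℝ))
    (by positivity) (h := fun z => 1 - twoPoint Λ z) (by fun_prop) fun z => by
      rw [v1, v1, ← e1]
      exact key _ fun k => v1 k z ▸ versine_nonneg _
  obtain ⟨p2, i2⟩ := integrable_inv_sqrt_of_versine_le hlm ((1 / 2 : ℝ) : UnitAddCircle)
    (C := 1 / (Λ.card : ℝ)) (by positivity) (h := fun z => 1 + twoPoint Λ z) (by fun_prop)
    fun z => by
      rw [v2, v2, ← e2]
      exact key _ fun k => v2 k z ▸ versine_nonneg _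
  refine ⟨p1.and p2, (i1.add i2).mono'
    (measurable_const.div (measurable_const.sub (hmeas.pow_const 2)).sqrt).aestronglyMeasurable ?_⟩
  filter_upwards [p1, p2] with z hz1 hz2
  rw [Real.norm_of_nonneg (by positivity)]
  exact inv_sqrt_one_sub_sq_le hz1 hz2

/-- For almost all `z` one has `|u(z)| < 1`, and the kernel `1 / √(1 - u(z)²)` is integrable. -/
theorem twoPoint_kernel (hd : 2 ≤ d) {Λ : Finset (Fin d → ℤ)} (hsymm : IsSymmetric Λ)
    (hnondeg : IsNondegenerate hd Λ) :
    (∀ᵐ z : UnitAddTorus (Fin d), 0 < 1 - twoPoint Λ z ∧ 0 < 1 + twoPoint Λ z) ∧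
      Integrable fun z : UnitAddTorus (Fin d) => 1 / √(1 - twoPoint Λ z ^ 2) := by
  obtain ⟨l, hl, -, -, h0, h1⟩ := hnondeg
  have hij : (⟨0, by omega⟩ : Fin d) ≠ ⟨1, by omega⟩ := by simp
  -- The second frequency is `l` with the sign of its first coordinate reversed; the determinant is
  -- then twice the product of the first two coordinates of `l`.
  refine twoPoint_kernel_of_mem (i := ⟨0, by omega⟩) (j := ⟨1, by omega⟩) hl
    (hsymm.sign_mem (Function.update 1 (⟨0, by omega⟩ : Fin d) (-1)) l hl) ?_
  rw [Function.update_self, Function.update_of_ne hij.symm]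
  have := mul_ne_zero h0 h1
  simp only [Pi.one_apply, Units.val_one, Units.val_neg]
  intro h
  apply this
  linarith

end Kernel

/-! ### Differentiation of measures along weighted balls -/

section Differentiation

open scoped ENNReal

/-- The bounds give `limsup F ≤ (1 + 1/(m+1)) liminf F` for every `m`, and finiteness already from
`m = 0`. -/
theorem exists_tendsto_of_sandwich {F : ℝ → ℝ≥0∞} {l : Filter ℝ} [l.NeBot]
    (h : ∀ m : ℕ, ∃ (lo up : ℝ → ℝ≥0∞) (L U : ℝ≥0∞), lo ≤ᶠ[l] F ∧ F ≤ᶠ[l] up ∧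
      Tendsto lo l (𝓝 L) ∧ Tendsto up l (𝓝 U) ∧ U ≠ ∞ ∧
      U ≤ (1 + ENNReal.ofReal (1 / ((m : ℝ) + 1))) * L) :
    ∃ L : ℝ≥0∞, L ≠ ∞ ∧ Tendsto F l (𝓝 L) := by
  have key : ∀ m : ℕ, limsup F l ≤ (1 + ENNReal.ofReal (1 / ((m : ℝ) + 1))) * liminf F l := by
    intro m
    obtain ⟨lo, up, L, U, h1, h2, h3, h4, -, h6⟩ := h m
    calc limsup F l ≤ limsup up l := limsup_le_limsup h2
      _ = U := h4.limsup_eq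
      _ ≤ _ := h6
      _ = (1 + ENNReal.ofReal (1 / ((m : ℝ) + 1))) * liminf lo l := by rw [h3.liminf_eq]
      _ ≤ _ := by gcongr; exact liminf_le_liminf h1
  have hfin : limsup F l ≠ ∞ := by
    obtain ⟨lo, up, L, U, -, h2, -, h4, h5, -⟩ := h 0
    exact ne_top_of_le_ne_top h5 ((limsup_le_limsup h2).trans h4.limsup_eq.le)
  have hle : liminf F l ≤ limsup F l := liminf_le_limsup
  have hlim : Tendsto (fun m : ℕ => (1 + ENNReal.ofReal (1 / ((m : ℝ) + 1))) * liminf F l) atTop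
      (𝓝 ((1 + ENNReal.ofReal 0) * liminf F l)) :=
    ENNReal.Tendsto.mul_const (tendsto_const_nhds.add
      (ENNReal.tendsto_ofReal tendsto_one_div_add_atTop_nhds_zero_nat))
      (Or.inr (ne_top_of_le_ne_top hfin hle))
  rw [ENNReal.ofReal_zero, add_zero, one_mul] at hlim
  exact ⟨limsup F l, hfin, tendsto_of_le_liminf_of_limsup_le
    (ge_of_tendsto' hlim key) le_rfl⟩

theorem tendsto_measure_closedBall_div {ρ : Measure ℝ} {b t : ℝ} (ht : 0 < t) {D : ℝ≥0∞}
    (h : Tendsto (fun r => ρ (Metric.closedBall b r) / volume (Metric.closedBall b r))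
      (𝓝[>] 0) (𝓝 D)) :
    Tendsto (fun ε => ρ (Metric.closedBall b (ε / t)) / ENNReal.ofReal (2 * ε)) (𝓝[>] 0)
      (𝓝 (D * ENNReal.ofReal (1 / t))) := by
  have hdiv : Tendsto (fun ε : ℝ => ε / t) (𝓝[>] 0) (𝓝[>] 0) := by
    refine tendsto_nhdsWithin_iff.2 ⟨?_, ?_⟩
    · have : Tendsto (fun ε : ℝ => ε / t) (𝓝 0) (𝓝 (0 / t)) := tendsto_id.div_const t
      rw [zero_div] at this
      exact this.mono_left nhdsWithin_le_nhds
    · filter_upwards [self_mem_nhdsWithin] with ε hε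
      exact div_pos hε ht
  refine (ENNReal.Tendsto.mul_const (h.comp hdiv) (Or.inr ENNReal.ofReal_ne_top)).congr' ?_
  filter_upwards [self_mem_nhdsWithin] with ε (hε : 0 < ε)
  have e : ENNReal.ofReal (2 * ε) = ENNReal.ofReal (2 * (ε / t)) * ENNReal.ofReal t := by
    rw [← ENNReal.ofReal_mul (by positivity)]
    congr 1
    field_simp
  have ht' : ENNReal.ofReal t ≠ 0 := (ENNReal.ofReal_pos.2 ht).ne'
  rw [Function.comp, Real.volume_closedBall, e]
  generalize ε / t = r
  rw [one_div, ENNReal.ofReal_inv_of_pos ht,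
    div_eq_mul_inv, div_eq_mul_inv, ENNReal.mul_inv (Or.inr ENNReal.ofReal_ne_top) (Or.inr ht'),
    mul_assoc]

variable {X : Type*} [MeasurableSpace X]

/-- For a weight `w` bounded away from `0` and `∞`, the distribution of `H` can be differentiated at
almost every `b` along the sets `{w |H - b| < ε}`. -/
theorem ae_exists_tendsto_weighted (ν : Measure X) [IsFiniteMeasure ν] {H w : X → ℝ}
    (hH : Measurable H) (hw : Measurable w) {κ : ℝ} (hκ : 0 < κ)
    (hw1 : ∀ x, κ / 2 ≤ w x) (hw2 : ∀ x, w x ≤ κ) :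
    ∀ᵐ b : ℝ, ∃ L : ℝ≥0∞, L ≠ ∞ ∧
      Tendsto (fun ε => ν {x | w x * |H x - b| < ε} / ENNReal.ofReal (2 * ε)) (𝓝[>] 0) (𝓝 L) := by
  -- Slice `X` by the value of `w`, with mesh `κ / (2(m+1))`. On a slice `w` is nearly constant, so
  -- the weighted set lies between preimages of two balls about `b`, and ordinary differentiation
  -- applies to the countably many image measures `ρ m j`.
  let slice : ℕ → ℕ → Set X := fun m j => {x | ⌊2 * ((m : ℝ) + 1) * w x / κ⌋₊ = j}
  have hslice : ∀ m j, MeasurableSet (slice m j) := fun m j =>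
    (Nat.measurable_floor.comp ((hw.const_mul _).div_const κ)) (measurableSet_singleton j)
  let ρ : ℕ → ℕ → Measure ℝ := fun m j => (ν.restrict (slice m j)).map H
  have hρ : ∀ m j b r, ρ m j (Metric.closedBall b r) = ν (H ⁻¹' Metric.closedBall b r ∩ slice m j) :=
    fun m j b r => by
      rw [Measure.map_apply hH Metric.isClosed_closedBall.measurableSet,
        Measure.restrict_apply (hH Metric.isClosed_closedBall.measurableSet)]
  have hfin : ∀ m j, IsFiniteMeasure (ρ m j) := fun m j => inferInstance
  have h1 : ∀ᵐ b : ℝ, ∀ m j, Tendsto (fun r => ρ m j (Metric.closedBall b r) /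
      volume (Metric.closedBall b r)) (𝓝[>] 0) (𝓝 ((ρ m j).rnDeriv volume b)) :=
    ae_all_iff.2 fun m => ae_all_iff.2 fun j => Besicovitch.ae_tendsto_rnDeriv _ _
  have h2 : ∀ᵐ b : ℝ, ∀ m j, (ρ m j).rnDeriv volume b < ∞ :=
    ae_all_iff.2 fun m => ae_all_iff.2 fun j => Measure.rnDeriv_lt_top _ _
  filter_upwards [h1, h2] with b hb1 hb2
  refine exists_tendsto_of_sandwich fun m => ?_
  set M : ℝ := (m : ℝ) + 1 with hM
  have hMpos : 0 < M := by positivity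
  -- These indices cover `κ/2 ≤ w ≤ κ`; the top one is reached only at `w = κ`.
  let J := Finset.Icc (m + 1) (2 * (m + 1))
  let t : ℕ → ℝ := fun j => j * κ / (2 * M)
  have htpos : ∀ j, m + 1 ≤ j → 0 < t j := fun j hj => by
    have : (0 : ℝ) < j := by exact_mod_cast (by omega : 0 < j)
    positivity
  have hmem : ∀ x j, x ∈ slice m j → t j ≤ w x ∧ w x < t (j + 1) := fun x j hx => by
    have h0 : 0 ≤ 2 * M * w x / κ := by
      have := (half_pos hκ).le.trans (hw1 x)
      positivity
    obtain ⟨ha, hb⟩ := (Nat.floor_eq_iff h0).1 hx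
    rw [le_div_iff₀ hκ] at ha
    rw [div_lt_iff₀ hκ] at hb
    constructor
    · rw [div_le_iff₀ (by positivity)]; linarith
    · rw [lt_div_iff₀ (by positivity)]; push_cast; linarith
  have hcover : ∀ x, ⌊2 * M * w x / κ⌋₊ ∈ J := fun x => by
    have e1 : (m + 1 : ℕ) ≤ 2 * M * w x / κ := by
      rw [le_div_iff₀ hκ]; push_cast; nlinarith [hw1 x]
    have e2 : 2 * M * w x / κ ≤ (2 * (m + 1) : ℕ) := by
      rw [div_le_iff₀ hκ]; push_cast; nlinarith [hw2 x]
    exact Finset.mem_Icc.2 ⟨Nat.le_floor e1, Nat.floor_le_of_le e2⟩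
  have hdisj : ∀ i ∈ J, ∀ j ∈ J, i ≠ j → Disjoint (slice m i) (slice m j) := fun i _ j _ hij =>
    Set.disjoint_left.2 fun x (hi : _ = i) (hj : _ = j) => hij (hi.symm.trans hj)
  refine ⟨fun ε => ∑ j ∈ J, ρ m j (Metric.closedBall b (ε / t (j + 1))) / ENNReal.ofReal (2 * ε),
    fun ε => ∑ j ∈ J, ρ m j (Metric.closedBall b (ε / t j)) / ENNReal.ofReal (2 * ε),
    ∑ j ∈ J, (ρ m j).rnDeriv volume b * ENNReal.ofReal (1 / t (j + 1)),
    ∑ j ∈ J, (ρ m j).rnDeriv volume b * ENNReal.ofReal (1 / t j), ?_, ?_, ?_, ?_, ?_, ?_⟩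
  · filter_upwards [self_mem_nhdsWithin] with ε (hε : 0 < ε)
    simp only [div_eq_mul_inv (b := ENNReal.ofReal (2 * ε)), ← Finset.sum_mul]
    gcongr
    simp only [hρ]
    rw [← measure_biUnion_finset (fun i hi j hj hij => (hdisj i hi j hj hij).mono
      Set.inter_subset_right Set.inter_subset_right) fun j _ =>
        (hH Metric.isClosed_closedBall.measurableSet).inter (hslice m j)]
    refine measure_mono (Set.iUnion₂_subset fun j hj x hx => ?_)
    obtain ⟨hx1, hx2⟩ := hx
    rw [Set.mem_preimage, Metric.mem_closedBall, Real.dist_eq] at hx1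
    have ht := htpos (j + 1) (by have := (Finset.mem_Icc.1 hj).1; omega)
    rw [le_div_iff₀ ht] at hx1
    have hwx := (hmem x j hx2).2
    change w x * |H x - b| < ε
    -- The balls are closed but the target inequality is strict. Strictness comes from `w x < t (j +
    -- 1)`, except when `H x = b`, where it comes from `ε > 0`.
    rcases eq_or_lt_of_le (abs_nonneg (H x - b)) with h0 | h0
    · rw [← h0, mul_zero]; exact hε
    · nlinarith
  · filter_upwards [self_mem_nhdsWithin] with ε (hε : 0 < ε)
    simp only [div_eq_mul_inv (b := ENNReal.ofReal (2 * ε)), ← Finset.sum_mul]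
    gcongr
    simp only [hρ]
    refine le_trans (measure_mono fun x hx => ?_) (measure_biUnion_finset_le _ _)
    refine Set.mem_biUnion (hcover x) ⟨?_, rfl⟩
    have hj := (Finset.mem_Icc.1 (hcover x)).1
    have ht := htpos _ hj
    have hwx := (hmem x _ rfl).1
    rw [Set.mem_preimage, Metric.mem_closedBall, Real.dist_eq, le_div_iff₀ ht]
    have hx' : w x * |H x - b| < ε := hx
    nlinarith [abs_nonneg (H x - b)]
  · exact tendsto_finsetSum _ fun j hj => tendsto_measure_closedBall_div
      (htpos (j + 1) (by have := (Finset.mem_Icc.1 hj).1; omega)) (hb1 m j)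
  · exact tendsto_finsetSum _ fun j hj => tendsto_measure_closedBall_div
      (htpos j (Finset.mem_Icc.1 hj).1) (hb1 m j)
  · exact ENNReal.sum_ne_top.2 fun j _ => ENNReal.mul_ne_top (hb2 m j).ne ENNReal.ofReal_ne_top
  · rw [Finset.mul_sum]
    refine Finset.sum_le_sum fun j hj => ?_
    rw [mul_left_comm]
    gcongr
    rw [← ENNReal.ofReal_one, ← ENNReal.ofReal_add zero_le_one (by positivity),
      ← ENNReal.ofReal_mul (by positivity)]
    refine ENNReal.ofReal_le_ofReal ?_
    have hj1 : M ≤ j := by rw [hM]; exact_mod_cast (Finset.mem_Icc.1 hj).1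
    have hj0 : (0 : ℝ) < j := hMpos.trans_le hj1
    simp only [t]
    push_cast
    rw [one_div_div, one_div_div, ← sub_nonneg]
    -- This is `t (j + 1) / t j = (j + 1) / j ≤ 1 + 1 / M`, valid since `j ≥ M`.
    have : (1 + 1 / M) * (2 * M / ((j + 1) * κ)) - 2 * M / (j * κ) =
        2 * (j - M) / (j * (j + 1) * κ) := by
      field_simp
      ring
    rw [this]
    have : 0 ≤ (j : ℝ) - M := by linarith
    positivity

theorem ae_exists_tendsto_affine (μ : Measure X) [IsFiniteMeasure μ] {h g : X → ℝ}
    (hh : Measurable h) (hg : Measurable g) {A : Set X} (hA : MeasurableSet A) {κ : ℝ} (hκ : 0 < κ)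
    (hg1 : ∀ x ∈ A, κ / 2 ≤ |g x|) (hg2 : ∀ x ∈ A, |g x| ≤ κ) :
    ∀ᵐ b : ℝ, ∃ L : ℝ, Tendsto (fun ε => 1 / (2 * ε) * μ.real ({x | |h x + b * g x| < ε} ∩ A))
      (𝓝[>] 0) (𝓝 L) := by
  have hab : Measurable fun x => |g x| := hg.norm
  -- The weight is `|g|` truncated to `[κ/2, κ]`, so that its bounds hold everywhere; on `A` the
  -- truncation does nothing.
  filter_upwards [ae_exists_tendsto_weighted (μ.restrict A) (H := fun x => -(h x / g x))
    (w := fun x => max (κ / 2) (min κ |g x|)) (hh.div hg).neg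
    (measurable_const.max (measurable_const.min hab)) hκ (fun x => le_max_left _ _)
    (fun x => max_le (by linarith) (min_le_left _ _))] with b hb
  obtain ⟨L, hL, hlim⟩ := hb
  refine ⟨L.toReal, ((ENNReal.tendsto_toReal hL).comp hlim).congr' ?_⟩
  filter_upwards [self_mem_nhdsWithin] with ε (hε : 0 < ε)
  rw [Function.comp, ENNReal.toReal_div, ENNReal.toReal_ofReal (by positivity), div_eq_inv_mul,
    one_div, Measure.restrict_apply' hA, Measure.real]
  congr 3
  ext x
  simp only [Set.mem_inter_iff, Set.mem_ofPred_eq, and_congr_left_iff]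
  intro hx
  have hgx : g x ≠ 0 := abs_pos.1 ((half_pos hκ).trans_le (hg1 x hx))
  rw [min_eq_right (hg2 x hx), max_eq_right (hg1 x hx), ← abs_mul]
  have : g x * (-(h x / g x) - b) = -(h x + b * g x) := by
    field_simp
    ring
  rw [this, abs_neg]

/-- With `n = ⌊1/ε⌋` one has `1/(n+1) < ε ≤ 1/n`; monotonicity of `V` costs only factors `n/(n+1)`
and its inverse. Existence of the limit can thus be tested along a sequence, where it is a
measurable condition. -/
theorem tendsto_div_of_tendsto_seq {V : ℝ → ℝ} (hV : Monotone V) (hV0 : ∀ ε, 0 ≤ V ε) {L : ℝ}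
    (h : Tendsto (fun n : ℕ => 1 / (2 * (1 / ((n : ℝ) + 1))) * V (1 / ((n : ℝ) + 1))) atTop (𝓝 L)) :
    Tendsto (fun ε => 1 / (2 * ε) * V ε) (𝓝[>] 0) (𝓝 L) := by
  set a : ℕ → ℝ := fun n => 1 / (2 * (1 / ((n : ℝ) + 1))) * V (1 / ((n : ℝ) + 1))
  have hfl : Tendsto (fun ε : ℝ => ⌊ε⁻¹⌋₊) (𝓝[>] 0) atTop :=
    tendsto_nat_floor_atTop.comp tendsto_inv_nhdsGT_zero
  have hlo : Tendsto (fun n : ℕ => a n * ((n : ℝ) / (n + 1))) atTop (𝓝 L) := by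
    simpa using h.mul (tendsto_natCast_div_add_atTop (1 : ℝ))
  -- Index `n - 1` corresponds to the scale `1/n`; truncated subtraction is harmless because `n ≥ 1`
  -- eventually.
  have hup : Tendsto (fun n : ℕ => a (n - 1) * (((n : ℝ) / (n + 1)))⁻¹) atTop (𝓝 L) := by
    simpa using (h.comp (tendsto_sub_atTop_nat 1)).mul
      ((tendsto_natCast_div_add_atTop (1 : ℝ)).inv₀ one_ne_zero)
  refine tendsto_of_tendsto_of_tendsto_of_le_of_le' (hlo.comp hfl) (hup.comp hfl) ?_ ?_
  · filter_upwards [self_mem_nhdsWithin, hfl.eventually_ge_atTop 1] with ε (hε : 0 < ε) h1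
    have hn := Nat.floor_le (inv_pos.2 hε).le
    have hn' := Nat.lt_floor_add_one ε⁻¹
    simp only [Function.comp, a]
    set n := ⌊ε⁻¹⌋₊
    have hle : 1 / ((n : ℝ) + 1) ≤ ε := by
      rw [one_div]; exact inv_le_of_inv_le₀ hε hn'.le
    have e : 1 / (2 * (1 / ((n : ℝ) + 1))) * V (1 / ((n : ℝ) + 1)) * ((n : ℝ) / (n + 1)) =
        n / 2 * V (1 / ((n : ℝ) + 1)) := by
      field_simp
    have e' : 1 / (2 * ε) = ε⁻¹ / 2 := by field_simp
    rw [e, e']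
    exact mul_le_mul (by linarith) (hV hle) (hV0 _) (by positivity)
  · filter_upwards [self_mem_nhdsWithin, hfl.eventually_ge_atTop 1] with ε (hε : 0 < ε) h1
    have hn := Nat.floor_le (inv_pos.2 hε).le
    have hn' := Nat.lt_floor_add_one ε⁻¹
    simp only [Function.comp, a]
    set n := ⌊ε⁻¹⌋₊
    have hnpos : (0 : ℝ) < n := by exact_mod_cast h1
    rw [Nat.cast_sub h1, Nat.cast_one, sub_add_cancel]
    have hle : ε ≤ 1 / (n : ℝ) := by
      rw [one_div]; exact le_inv_of_le_inv₀ hnpos hn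
    have e : 1 / (2 * (1 / (n : ℝ))) * V (1 / (n : ℝ)) * ((n : ℝ) / (n + 1))⁻¹ =
        (n + 1) / 2 * V (1 / (n : ℝ)) := by
      field_simp
    have e' : 1 / (2 * ε) = ε⁻¹ / 2 := by field_simp
    rw [e, e']
    exact mul_le_mul (by linarith) (hV hle) (hV0 _) (by positivity)

end Differentiation

/-! ### Almost sure existence of the Leray measure -/

section Existence

open scoped ENNReal

/-- Resampling one coordinate independently does not change a product law; this is how the other
coefficients get frozen. -/
theorem measurePreserving_update {ι : Type*} [Fintype ι] [DecidableEq ι] {Ω : ι → Type*}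
    [∀ i, MeasurableSpace (Ω i)] (μ : ∀ i, Measure (Ω i)) [∀ i, IsProbabilityMeasure (μ i)] (i : ι) :
    MeasurePreserving (fun p : (∀ j, Ω j) × Ω i => Function.update p.1 i p.2)
      ((Measure.pi μ).prod (μ i)) (Measure.pi μ) := by
  have hm : Measurable fun p : (∀ j, Ω j) × Ω i => Function.update p.1 i p.2 := by
    refine measurable_pi_lambda _ fun j => ?_
    by_cases h : j = i
    · subst h
      simpa using measurable_snd
    · simpa [Function.update_of_ne h, Function.comp_def] using
        (measurable_pi_apply j).comp measurable_fst
  refine ⟨hm, (Measure.pi_eq fun s hs => ?_).symm⟩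
  have e : (fun p : (∀ j, Ω j) × Ω i => Function.update p.1 i p.2) ⁻¹' Set.univ.pi s =
      (Set.univ.pi (Function.update s i Set.univ)) ×ˢ s i := by
    ext p
    simp only [Set.mem_preimage, Set.mem_pi, Set.mem_univ, true_implies, Set.mem_prod]
    constructor
    · intro h
      refine ⟨fun j => ?_, by simpa using h i⟩
      by_cases hj : j = i
      · subst hj; simp
      · simpa [Function.update_of_ne hj] using h j
    · rintro ⟨h1, h2⟩ j
      by_cases hj : j = i
      · subst hj; simpa using h2
      · simpa [Function.update_of_ne hj] using h1 j
  rw [Measure.map_apply hm (MeasurableSet.univ_pi hs), e, Measure.prod_prod, Measure.pi_pi,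
    ← Finset.mul_prod_erase _ _ (Finset.mem_univ i),
    ← Finset.mul_prod_erase (Finset.univ) (fun j => μ j (s j)) (Finset.mem_univ i),
    Function.update_self, measure_univ, one_mul, mul_comm]
  congr 1
  refine Finset.prod_congr rfl fun j hj => ?_
  rw [Function.update_of_ne (Finset.ne_of_mem_erase hj)]

variable {d : ℕ} {Λ R : Finset (Fin d → ℤ)}

theorem continuous_randomFunction :
    Continuous fun p : Coeff R × UnitAddTorus (Fin d) => randomFunction Λ R p.1 p.2 := by
  unfold randomFunction
  refine continuous_const.mul (continuous_finsetSum _ fun l _ => ?_)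
  have h1 := (continuous_cosMode l.1).comp (continuous_snd (X := Coeff R))
  have h2 := (continuous_sinMode l.1).comp (continuous_snd (X := Coeff R))
  have h3 : Continuous fun p : Coeff R × UnitAddTorus (Fin d) => p.1 l :=
    (continuous_apply l).comp continuous_fst
  exact (h3.fst.mul h1).sub (h3.snd.mul h2)

theorem continuous_randomFunction_right (Z : Coeff R) : Continuous (randomFunction Λ R Z) :=
  continuous_randomFunction.comp (Continuous.prodMk_right Z)

theorem measurable_measure_abs_lt_inter (ε : ℝ) {A : Set (UnitAddTorus (Fin d))}
    (hA : MeasurableSet A) :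
    Measurable fun Z : Coeff R => volume.real ({x | |randomFunction Λ R Z x| < ε} ∩ A) := by
  have hS : MeasurableSet ({p : Coeff R × UnitAddTorus (Fin d) |
      |randomFunction Λ R p.1 p.2| < ε} ∩ Prod.snd ⁻¹' A) :=
    (measurableSet_lt continuous_randomFunction.measurable.norm measurable_const).inter
      (measurable_snd hA)
  exact (measurable_measure_prodMk_left (ν := volume) hS).ennreal_toReal

theorem randomFunction_add_smul (Z W : Coeff R) (b : ℝ) (x : UnitAddTorus (Fin d)) :
    randomFunction Λ R (Z + b • W) x =
      randomFunction Λ R Z x + b * randomFunction Λ R W x := by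
  simp only [randomFunction_eq, map_add, map_smul, smul_eq_mul]

theorem ae_of_forall_ae_update (l : {l // l ∈ R}) {S : Set (Coeff R)} (hS : MeasurableSet S)
    (h : ∀ Z : Coeff R, ∀ᵐ w ∂(gaussianReal 0 1).prod (gaussianReal 0 1),
      Function.update Z l w ∈ S) : ∀ᵐ Z ∂(gaussianEnsemble R), Z ∈ S := by
  have hmp := measurePreserving_update
    (fun _ : {l // l ∈ R} => (gaussianReal 0 1).prod (gaussianReal 0 1)) l
  have : ∀ᵐ p ∂(gaussianEnsemble R).prod ((gaussianReal 0 1).prod (gaussianReal 0 1)),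
      Function.update p.1 l p.2 ∈ S :=
    (Measure.ae_prod_iff_ae_ae (hmp.measurable hS)).2 (Eventually.of_forall h)
  rw [gaussianEnsemble, ← hmp.map_eq]
  exact (ae_map_iff hmp.measurable.aemeasurable hS).2 this

/-- Convergence, along `ε = 1 / (n + 1)`, of the part of the Leray measure carried by `A`. -/
def convergenceSet (Λ R : Finset (Fin d → ℤ)) (A : Set (UnitAddTorus (Fin d))) : Set (Coeff R) :=
  {Z | ∃ L : ℝ, Tendsto (fun n : ℕ => 1 / (2 * (1 / ((n : ℝ) + 1))) *
    volume.real ({x | |randomFunction Λ R Z x| < 1 / ((n : ℝ) + 1)} ∩ A)) atTop (𝓝 L)}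

theorem measurableSet_convergenceSet {A : Set (UnitAddTorus (Fin d))} (hA : MeasurableSet A) :
    MeasurableSet (convergenceSet Λ R A) :=
  measurableSet_exists_tendsto fun _ => (measurable_measure_abs_lt_inter _ hA).const_mul _

theorem tendsto_one_div_add_nhdsGT :
    Tendsto (fun n : ℕ => 1 / ((n : ℝ) + 1)) atTop (𝓝[>] 0) :=
  tendsto_nhdsWithin_iff.2 ⟨tendsto_one_div_add_atTop_nhds_zero_nat,
    Eventually.of_forall fun n => by simp only [Set.mem_Ioi]; positivity⟩

theorem ae_add_smul_mem_convergenceSet {A : Set (UnitAddTorus (Fin d))} (hA : MeasurableSet A)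
    {κ : ℝ} (hκ : 0 < κ) (Z W : Coeff R)
    (h : ∀ x ∈ A, κ / 2 ≤ |randomFunction Λ R W x| ∧ |randomFunction Λ R W x| ≤ κ) :
    ∀ᵐ b ∂(gaussianReal 0 1), Z + b • W ∈ convergenceSet Λ R A := by
  refine (gaussianReal_absolutelyContinuous 0 one_ne_zero).ae_le ?_
  filter_upwards [ae_exists_tendsto_affine volume
    (continuous_randomFunction_right (Λ := Λ) Z).measurable
    (continuous_randomFunction_right (Λ := Λ) W).measurable hA hκ (fun x hx => (h x hx).1)
    (fun x hx => (h x hx).2)] with b ⟨L, hL⟩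
  refine ⟨L, ?_⟩
  simp only [randomFunction_add_smul]
  exact hL.comp tendsto_one_div_add_nhdsGT

theorem randomFunction_single (l : {l // l ∈ R}) (w : ℝ × ℝ) (x : UnitAddTorus (Fin d)) :
    randomFunction Λ R (Pi.single l w) x =
      √(2 / (Λ.card : ℝ)) * (w.1 * cosMode l.1 x - w.2 * sinMode l.1 x) := by
  rw [randomFunction, Finset.sum_eq_single l]
  · simp
  · intro m _ hm; simp [hm]
  · simp

theorem update_eq_add_smul (l : {l // l ∈ R}) (Z : Coeff R) (b c : ℝ) :
    Function.update Z l (b, c) =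
      Function.update Z l (0, c) + b • (Pi.single l ((1, 0) : ℝ × ℝ) : Coeff R) ∧
    Function.update Z l (b, c) =
      Function.update Z l (b, 0) + c • (Pi.single l ((0, 1) : ℝ × ℝ) : Coeff R) := by
  constructor <;>
  · ext m <;>
    · by_cases h : m = l
      · subst h; simp
      · simp [h]

theorem ae_mem_convergenceSet_cos (hΛ : 0 < Λ.card) (l : {l // l ∈ R}) :
    ∀ᵐ Z ∂(gaussianEnsemble R), Z ∈ convergenceSet Λ R {x | 1 / 2 ≤ |cosMode l.1 x|} := by
  have hA : MeasurableSet {x : UnitAddTorus (Fin d) | 1 / 2 ≤ |cosMode l.1 x|} :=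
    measurableSet_le measurable_const (continuous_cosMode l.1).measurable.norm
  have hS := measurableSet_convergenceSet (Λ := Λ) (R := R) hA
  have hκ : 0 < √(2 / (Λ.card : ℝ)) := by positivity
  refine ae_of_forall_ae_update l hS fun Z => ?_
  have hm : Measurable fun w : ℝ × ℝ => Function.update Z l w := measurable_update Z
  refine (Measure.ae_prod_iff_ae_ae (μ := gaussianReal 0 1) (ν := gaussianReal 0 1)
    (p := fun w => Function.update Z l w ∈ _) (hm hS)).2 ?_
  -- The differentiation is in the cosine coefficient `b`, so `c` must be the variable fixed first.
  refine (Measure.ae_ae_comm (p := fun b c => Function.update Z l (b, c) ∈ _) (hm hS)).2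
    (Eventually.of_forall fun c => ?_)
  refine (ae_add_smul_mem_convergenceSet hA hκ (Function.update Z l (0, c)) (Pi.single l (1, 0))
    fun x hx => ?_).mono fun b hb => by rwa [(update_eq_add_smul l Z b c).1]
  rw [randomFunction_single]
  have hx' : 1 / 2 ≤ |cosMode l.1 x| := hx
  have h1 : |cosMode l.1 x| ≤ 1 := abs_le_one_iff_mul_self_le_one.2 (by
    nlinarith [cosMode_sq_add_sinMode_sq l.1 x, sq_nonneg (sinMode l.1 x)])
  simp only [one_mul, zero_mul, sub_zero, abs_mul, abs_of_pos hκ]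
  constructor <;> nlinarith

/-- Where `|cos| < 1/2`, the identity `cos² + sin² = 1` forces `|sin| ≥ 1/2`, so the sine
coefficient can be varied there. -/
theorem ae_mem_convergenceSet_sin (hΛ : 0 < Λ.card) (l : {l // l ∈ R}) :
    ∀ᵐ Z ∂(gaussianEnsemble R), Z ∈ convergenceSet Λ R {x | 1 / 2 ≤ |cosMode l.1 x|}ᶜ := by
  have hA : MeasurableSet {x : UnitAddTorus (Fin d) | 1 / 2 ≤ |cosMode l.1 x|} :=
    measurableSet_le measurable_const (continuous_cosMode l.1).measurable.norm
  have hS := measurableSet_convergenceSet (Λ := Λ) (R := R) hA.compl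
  have hκ : 0 < √(2 / (Λ.card : ℝ)) := by positivity
  refine ae_of_forall_ae_update l hS fun Z => ?_
  have hm : Measurable fun w : ℝ × ℝ => Function.update Z l w := measurable_update Z
  refine (Measure.ae_prod_iff_ae_ae (μ := gaussianReal 0 1) (ν := gaussianReal 0 1)
    (p := fun w => Function.update Z l w ∈ _) (hm hS)).2 (Eventually.of_forall fun b => ?_)
  refine (ae_add_smul_mem_convergenceSet hA.compl hκ (Function.update Z l (b, 0))
    (Pi.single l (0, 1)) fun x hx => ?_).mono fun c hc => by rwa [(update_eq_add_smul l Z b c).2]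
  rw [randomFunction_single]
  have hx' : |cosMode l.1 x| < 1 / 2 := not_le.1 hx
  have h0 := cosMode_sq_add_sinMode_sq l.1 x
  have h1 : |sinMode l.1 x| ≤ 1 := abs_le_one_iff_mul_self_le_one.2 (by
    nlinarith [sq_nonneg (cosMode l.1 x)])
  have h2 : 1 / 2 ≤ |sinMode l.1 x| := by
    rw [← sq_abs (cosMode l.1 x), ← sq_abs (sinMode l.1 x)] at h0
    nlinarith [abs_nonneg (cosMode l.1 x), abs_nonneg (sinMode l.1 x)]
  simp only [one_mul, zero_mul, zero_sub, abs_mul, abs_neg, abs_of_pos hκ]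
  constructor <;> nlinarith

theorem tendsto_lerayApprox_of_mem {Z : Coeff R} {A : Set (UnitAddTorus (Fin d))}
    (hA : MeasurableSet A) (h1 : Z ∈ convergenceSet Λ R A) (h2 : Z ∈ convergenceSet Λ R Aᶜ) :
    ∃ L : ℝ, Tendsto (lerayApprox (randomFunction Λ R Z)) (𝓝[>] 0) (𝓝 L) := by
  obtain ⟨L1, h1⟩ := h1
  obtain ⟨L2, h2⟩ := h2
  refine ⟨L1 + L2, tendsto_div_of_tendsto_seq
    (V := fun ε => volume.real {x | |randomFunction Λ R Z x| < ε})
    (fun ε δ h => measureReal_mono fun x (hx : _ < ε) => lt_of_lt_of_le hx h)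
    (fun ε => measureReal_nonneg) ((h1.add h2).congr fun n => ?_)⟩
  rw [← mul_add, ← Set.sdiff_eq, measureReal_inter_add_sdiff hA]

/-- The limit defining the Leray measure exists almost surely. -/
theorem ae_exists_tendsto_lerayApprox (hΛ : 0 < Λ.card) (hR : R.Nonempty) :
    ∀ᵐ Z ∂(gaussianEnsemble R), ∃ L : ℝ,
      Tendsto (lerayApprox (randomFunction Λ R Z)) (𝓝[>] 0) (𝓝 L) := by
  obtain ⟨l, hl⟩ := hR
  filter_upwards [ae_mem_convergenceSet_cos hΛ ⟨l, hl⟩, ae_mem_convergenceSet_sin hΛ ⟨l, hl⟩]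
    with Z h1 h2
  exact tendsto_lerayApprox_of_mem
    (measurableSet_le measurable_const (continuous_cosMode l).measurable.norm) h1 h2

end Existence

/-! ### Convergence in mean square -/

section MeanSquare

open scoped ENNReal RealInnerProductSpace

/-- Expand `‖x n - x m‖² = ‖x n‖² - 2⟪x n, x m⟫ + ‖x m‖²`. It tends to `I - 2I + I = 0` because the
limit of the inner products is joint in both indices. -/
theorem exists_tendsto_of_tendsto_inner {E : Type*} [NormedAddCommGroup E] [InnerProductSpace ℝ E]
    [CompleteSpace E] {x : ℕ → E} {I : ℝ}
    (h : Tendsto (fun p : ℕ × ℕ => ⟪x p.1, x p.2⟫) atTop (𝓝 I)) :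
    ∃ y, Tendsto x atTop (𝓝 y) ∧ ‖y‖ ^ 2 = I := by
  have hd : Tendsto (fun n : ℕ => (n, n)) atTop atTop := by
    rw [← prod_atTop_atTop_eq]
    exact tendsto_id.prodMk tendsto_id
  have h0 : Tendsto (fun n => ‖x n‖ ^ 2) atTop (𝓝 I) :=
    (h.comp hd).congr fun n => real_inner_self_eq_norm_sq _
  have h1 : Tendsto (fun p : ℕ × ℕ => p.1) atTop atTop := by
    rw [← prod_atTop_atTop_eq]; exact tendsto_fst
  have h2 : Tendsto (fun p : ℕ × ℕ => p.2) atTop atTop := by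
    rw [← prod_atTop_atTop_eq]; exact tendsto_snd
  have hc : CauchySeq x := by
    rw [cauchySeq_iff_tendsto_dist_atTop_0]
    have h3 : Tendsto (fun p : ℕ × ℕ => dist (x p.1) (x p.2) ^ 2) atTop (𝓝 0) := by
      have := ((h0.comp h1).sub (h.const_mul 2)).add (h0.comp h2)
      rw [show I - 2 * I + I = 0 by ring] at this
      refine this.congr fun p => ?_
      rw [dist_eq_norm, norm_sub_sq_real]
      rfl
    have h4 := h3.sqrt
    simpa using h4
  obtain ⟨y, hy⟩ := cauchySeq_tendsto_of_complete hc
  exact ⟨y, hy, tendsto_nhds_unique (hy.norm.pow 2) h0⟩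

/-- If the second moments `E (X n * X m)` converge to `I` and `X n` converges almost surely, then
the almost sure limit is square integrable with second moment `I`. -/
theorem memLp_and_integral_sq_of_tendsto {Ω : Type*} [MeasurableSpace Ω] {P : Measure Ω}
    {X : ℕ → Ω → ℝ} {Y : Ω → ℝ} {I : ℝ} (hX : ∀ n, MemLp (X n) 2 P)
    (hI : Tendsto (fun p : ℕ × ℕ => ∫ ω, X p.1 ω * X p.2 ω ∂P) atTop (𝓝 I))
    (hY : ∀ᵐ ω ∂P, Tendsto (fun n => X n ω) atTop (𝓝 (Y ω))) :
    MemLp Y 2 P ∧ ∫ ω, Y ω ^ 2 ∂P = I := by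
  have hin : ∀ n m, ⟪(hX n).toLp, (hX m).toLp⟫ = ∫ ω, X n ω * X m ω ∂P := fun n m => by
    rw [L2.inner_def]
    refine integral_congr_ae ?_
    filter_upwards [(hX n).coeFn_toLp, (hX m).coeFn_toLp] with ω h1 h2
    rw [h1, h2]
    exact mul_comm _ _
  obtain ⟨y, hy, hyI⟩ := exists_tendsto_of_tendsto_inner (x := fun n => (hX n).toLp) (I := I)
    (hI.congr fun p => (hin _ _).symm)
  -- A subsequence of the mean-square convergent sequence converges almost surely, which identifies
  -- its limit with `Y`.
  obtain ⟨ns, hns, hae⟩ := (tendstoInMeasure_of_tendsto_Lp hy).exists_seq_tendsto_ae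
  have hco : ∀ᵐ ω ∂P, ∀ n, (MemLp.toLp (X n) (hX n) : Ω → ℝ) ω = X n ω := ae_all_iff.2 fun n => (hX n).coeFn_toLp
  have hyY : y =ᵐ[P] Y := by
    filter_upwards [hae, hco, hY] with ω h1 h2 h3
    simp only [h2] at h1
    exact tendsto_nhds_unique h1 (h3.comp hns.tendsto_atTop)
  refine ⟨(Lp.memLp y).ae_eq hyY, ?_⟩
  rw [← hyI, ← real_inner_self_eq_norm_sq, L2.inner_def]
  refine integral_congr_ae ?_
  filter_upwards [hyY] with ω h
  rw [h, sq]
  rfl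

variable {d : ℕ} {Λ R : Finset (Fin d → ℤ)}

instance isProbabilityMeasure_unitAddTorus :
    IsProbabilityMeasure (volume : Measure (UnitAddTorus (Fin d))) :=
  ⟨by rw [volume_pi, Measure.pi_univ]; simp⟩

theorem memLp_lerayApprox (ε : ℝ) :
    MemLp (fun Z => lerayApprox (randomFunction Λ R Z) ε) 2 (gaussianEnsemble R) := by
  have hm := measurable_measure_abs_lt_inter (Λ := Λ) (R := R) ε MeasurableSet.univ
  simp only [Set.inter_univ] at hm
  refine MemLp.of_bound (hm.const_mul (1 / (2 * ε))).aestronglyMeasurable (|1 / (2 * ε)|)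
    (Eventually.of_forall fun Z => ?_)
  rw [Real.norm_eq_abs, lerayApprox, abs_mul]
  refine mul_le_of_le_one_right (abs_nonneg _) ?_
  rw [abs_of_nonneg measureReal_nonneg]
  exact measureReal_le_one

theorem measurableSet_pair_abs_lt (ε δ : ℝ) :
    MeasurableSet {p : Coeff R × UnitAddTorus (Fin d) × UnitAddTorus (Fin d) |
      |randomFunction Λ R p.1 p.2.1| < ε ∧ |randomFunction Λ R p.1 p.2.2| < δ} := by
  have h1 : Continuous fun p : Coeff R × UnitAddTorus (Fin d) × UnitAddTorus (Fin d) =>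
      randomFunction Λ R p.1 p.2.1 :=
    continuous_randomFunction.comp (continuous_fst.prodMk (continuous_fst.comp continuous_snd))
  have h2 : Continuous fun p : Coeff R × UnitAddTorus (Fin d) × UnitAddTorus (Fin d) =>
      randomFunction Λ R p.1 p.2.2 :=
    continuous_randomFunction.comp (continuous_fst.prodMk (continuous_snd.comp continuous_snd))
  exact (measurableSet_lt h1.measurable.norm measurable_const).inter
    (measurableSet_lt h2.measurable.norm measurable_const)

/-- For fixed `Z` the product of two measures is the measure of a product set; Fubini then moves the
expectation inside. -/
theorem integral_lerayApprox_mul (ε δ : ℝ) :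
    ∫ Z, lerayApprox (randomFunction Λ R Z) ε * lerayApprox (randomFunction Λ R Z) δ
        ∂(gaussianEnsemble R) =
      ∫ p : UnitAddTorus (Fin d) × UnitAddTorus (Fin d), 1 / (2 * ε) * (1 / (2 * δ)) *
        (gaussianEnsemble R).real
          {Z | |randomFunction Λ R Z p.1| < ε ∧ |randomFunction Λ R Z p.2| < δ} := by
  have hS := measurableSet_pair_abs_lt (Λ := Λ) (R := R) ε δ
  rw [integral_const_mul]
  have e1 : ∀ Z : Coeff R, lerayApprox (randomFunction Λ R Z) ε *
      lerayApprox (randomFunction Λ R Z) δ = 1 / (2 * ε) * (1 / (2 * δ)) *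
        ((volume : Measure (UnitAddTorus (Fin d) × UnitAddTorus (Fin d)))
          (Prod.mk Z ⁻¹' {p : Coeff R × UnitAddTorus (Fin d) × UnitAddTorus (Fin d) |
            |randomFunction Λ R p.1 p.2.1| < ε ∧
              |randomFunction Λ R p.1 p.2.2| < δ})).toReal := fun Z => by
    have : Prod.mk Z ⁻¹' {p : Coeff R × UnitAddTorus (Fin d) × UnitAddTorus (Fin d) |
        |randomFunction Λ R p.1 p.2.1| < ε ∧ |randomFunction Λ R p.1 p.2.2| < δ} =
        {x | |randomFunction Λ R Z x| < ε} ×ˢ {x | |randomFunction Λ R Z x| < δ} := rfl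
    rw [this, Measure.volume_eq_prod, Measure.prod_prod, ENNReal.toReal_mul, lerayApprox,
      lerayApprox, Measure.real, Measure.real]
    ring
  simp only [e1]
  rw [integral_const_mul]
  congr 1
  simp only [Measure.real]
  rw [integral_toReal (measurable_measure_prodMk_left hS).aemeasurable
      (Eventually.of_forall fun _ => measure_lt_top _ _),
    ← Measure.prod_apply hS, Measure.prod_apply_symm hS]
  exact (integral_toReal (measurable_measure_prodMk_right hS).aemeasurable
    (Eventually.of_forall fun _ => measure_lt_top _ _)).symm

theorem measurePreserving_sub_torus :
    MeasurePreserving (fun p : UnitAddTorus (Fin d) × UnitAddTorus (Fin d) => p.1 - p.2)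
      volume volume :=
  measurePreserving_fst.comp (measurePreserving_sub_prod volume volume)

theorem pair_moments (hsymm : IsSymmetric Λ) (hR : IsRepresentatives Λ R)
    (x y : UnitAddTorus (Fin d)) :
    ∫ Z, linearFunctional (evaluationCoeff Λ R x) Z * linearFunctional (evaluationCoeff Λ R y) Z
      ∂(gaussianEnsemble R) = twoPoint Λ (x - y) := by
  rw [← integral_randomFunction_mul hsymm.neg_mem hR x y]
  simp only [randomFunction_eq]

theorem smallBall_bounds (hsymm : IsSymmetric Λ) (hR : IsRepresentatives Λ R)
    {x y : UnitAddTorus (Fin d)} (h1 : 0 < 1 - twoPoint Λ (x - y))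
    (h2 : 0 < 1 + twoPoint Λ (x - y)) {ε δ : ℝ} (hε : 0 < ε) (hδ : 0 < δ) :
    1 / (2 * ε) * (1 / (2 * δ)) * (gaussianEnsemble R).real
        {Z | |randomFunction Λ R Z x| < ε ∧ |randomFunction Λ R Z y| < δ} ≤
      1 / (2 * Real.pi) * (1 / √(1 - twoPoint Λ (x - y) ^ 2)) ∧
    1 / (2 * Real.pi) * (1 / √(1 - twoPoint Λ (x - y) ^ 2)) * (Real.exp (-(0 + ε) ^ 2 / 2) *
        Real.exp (-(ε + δ) ^ 2 / (2 * √(1 - twoPoint Λ (x - y) ^ 2) ^ 2))) ≤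
      1 / (2 * ε) * (1 / (2 * δ)) * (gaussianEnsemble R).real
        {Z | |randomFunction Λ R Z x| < ε ∧ |randomFunction Λ R Z y| < δ} := by
  have hpos : 0 < 1 - twoPoint Λ (x - y) ^ 2 := by nlinarith
  have hs0 := Real.sqrt_pos.2 hpos
  have hs : twoPoint Λ (x - y) ^ 2 + √(1 - twoPoint Λ (x - y) ^ 2) ^ 2 = 1 := by
    rw [Real.sq_sqrt hpos.le]; ring
  have hxx := pair_moments hsymm hR x x
  have hyy := pair_moments hsymm hR y y
  rw [sub_self, twoPoint_zero hsymm.nonempty] at hxx hyy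
  have hxy := pair_moments hsymm hR x y
  have b1 := measure_linearFunctional_pair_le _ _ hs0 hs hxx hxy hyy hε hδ
  have b2 := le_measure_linearFunctional_pair _ _ hs0 hs hxx hxy hyy hε hδ
  simp only [← randomFunction_eq] at b1 b2
  have hc : 0 ≤ 1 / (2 * ε) * (1 / (2 * δ)) := by positivity
  have e : ∀ t : ℝ, 1 / (2 * ε) * (1 / (2 * δ)) * (4 * ε * δ * t) = t := fun t => by
    field_simp
    norm_num
  constructor
  · exact (mul_le_mul_of_nonneg_left b1 hc).trans (e _).le
  · refine le_trans ?_ (mul_le_mul_of_nonneg_left b2 hc)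
    rw [mul_assoc (4 * ε * δ), e]

theorem tendsto_smallBall (hsymm : IsSymmetric Λ) (hR : IsRepresentatives Λ R)
    {x y : UnitAddTorus (Fin d)} (h1 : 0 < 1 - twoPoint Λ (x - y))
    (h2 : 0 < 1 + twoPoint Λ (x - y)) {ι : Type*} {l : Filter ι} {ε δ : ι → ℝ}
    (hε0 : ∀ i, 0 < ε i) (hδ0 : ∀ i, 0 < δ i) (hε : Tendsto ε l (𝓝 0)) (hδ : Tendsto δ l (𝓝 0)) :
    Tendsto (fun i => 1 / (2 * ε i) * (1 / (2 * δ i)) * (gaussianEnsemble R).real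
        {Z | |randomFunction Λ R Z x| < ε i ∧ |randomFunction Λ R Z y| < δ i}) l
      (𝓝 (1 / (2 * Real.pi) * (1 / √(1 - twoPoint Λ (x - y) ^ 2)))) := by
  refine tendsto_of_tendsto_of_tendsto_of_le_of_le ?_ tendsto_const_nhds
    (fun i => (smallBall_bounds hsymm hR h1 h2 (hε0 i) (hδ0 i)).2)
    (fun i => (smallBall_bounds hsymm hR h1 h2 (hε0 i) (hδ0 i)).1)
  have t1 : Tendsto (fun i => Real.exp (-(0 + ε i) ^ 2 / 2)) l (𝓝 (Real.exp (-(0 + 0) ^ 2 / 2))) :=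
    (((tendsto_const_nhds.add hε).pow 2).neg.div_const 2).rexp
  have t2 : Tendsto (fun i => Real.exp (-(ε i + δ i) ^ 2 /
      (2 * √(1 - twoPoint Λ (x - y) ^ 2) ^ 2))) l
      (𝓝 (Real.exp (-(0 + 0) ^ 2 / (2 * √(1 - twoPoint Λ (x - y) ^ 2) ^ 2)))) :=
    (((hε.add hδ).pow 2).neg.div_const _).rexp
  simpa using (t1.mul t2).const_mul (1 / (2 * Real.pi) * (1 / √(1 - twoPoint Λ (x - y) ^ 2)))

/-- Dominated convergence, with the limit itself as the dominating function. Since `(x, y) ↦ x - y`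
preserves measure, the double integral reduces to one over `z`. -/
theorem tendsto_integral_lerayApprox_mul (hsymm : IsSymmetric Λ) (hR : IsRepresentatives Λ R)
    (hpos : ∀ᵐ z : UnitAddTorus (Fin d), 0 < 1 - twoPoint Λ z ∧ 0 < 1 + twoPoint Λ z)
    (hint : Integrable fun z : UnitAddTorus (Fin d) => 1 / √(1 - twoPoint Λ z ^ 2)) :
    Tendsto (fun p : ℕ × ℕ => ∫ Z, lerayApprox (randomFunction Λ R Z) (1 / ((p.1 : ℝ) + 1)) *
        lerayApprox (randomFunction Λ R Z) (1 / ((p.2 : ℝ) + 1)) ∂(gaussianEnsemble R)) atTop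
      (𝓝 (1 / (2 * Real.pi) *
        ∫ z : UnitAddTorus (Fin d), 1 / √(1 - twoPoint Λ z ^ 2))) := by
  have hsub := measurePreserving_sub_torus (d := d)
  have hpos' : ∀ᵐ p : UnitAddTorus (Fin d) × UnitAddTorus (Fin d),
      0 < 1 - twoPoint Λ (p.1 - p.2) ∧ 0 < 1 + twoPoint Λ (p.1 - p.2) :=
    hsub.quasiMeasurePreserving.ae
      (p := fun z => 0 < 1 - twoPoint Λ z ∧ 0 < 1 + twoPoint Λ z) hpos
  have hint' : Integrable fun p : UnitAddTorus (Fin d) × UnitAddTorus (Fin d) =>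
      1 / (2 * Real.pi) * (1 / √(1 - twoPoint Λ (p.1 - p.2) ^ 2)) :=
    hsub.integrable_comp_of_integrable
      (g := fun z => 1 / (2 * Real.pi) * (1 / √(1 - twoPoint Λ z ^ 2))) (hint.const_mul _)
  have e : 1 / (2 * Real.pi) * ∫ z : UnitAddTorus (Fin d), 1 / √(1 - twoPoint Λ z ^ 2) =
      ∫ p : UnitAddTorus (Fin d) × UnitAddTorus (Fin d),
        1 / (2 * Real.pi) * (1 / √(1 - twoPoint Λ (p.1 - p.2) ^ 2)) := by
    rw [← integral_const_mul]
    conv_lhs => rw [← hsub.map_eq]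
    exact integral_map hsub.aemeasurable
      (by rw [hsub.map_eq]; exact (hint.const_mul _).aestronglyMeasurable)
  have hp0 : ∀ n : ℕ, (0 : ℝ) < 1 / ((n : ℝ) + 1) := fun n => by positivity
  have h1 : Tendsto (fun p : ℕ × ℕ => 1 / ((p.1 : ℝ) + 1)) atTop (𝓝 0) := by
    rw [← prod_atTop_atTop_eq]
    exact tendsto_one_div_add_atTop_nhds_zero_nat.comp tendsto_fst
  have h2 : Tendsto (fun p : ℕ × ℕ => 1 / ((p.2 : ℝ) + 1)) atTop (𝓝 0) := by
    rw [← prod_atTop_atTop_eq]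
    exact tendsto_one_div_add_atTop_nhds_zero_nat.comp tendsto_snd
  rw [e]
  simp only [integral_lerayApprox_mul]
  refine tendsto_integral_filter_of_dominated_convergence _ (Eventually.of_forall fun q => ?_)
    (Eventually.of_forall fun q => ?_) hint' ?_
  · exact ((measurable_measure_prodMk_right
      (measurableSet_pair_abs_lt _ _)).ennreal_toReal.const_mul _).aestronglyMeasurable
  · filter_upwards [hpos'] with p hp
    have := hp0 q.1
    have := hp0 q.2
    rw [Real.norm_of_nonneg (by positivity)]
    exact (smallBall_bounds hsymm hR hp.1 hp.2 (hp0 _) (hp0 _)).1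
  · filter_upwards [hpos'] with p hp
    exact tendsto_smallBall hsymm hR hp.1 hp.2 (fun q => hp0 q.1) (fun q => hp0 q.2) h1 h2

end MeanSquare

end LerayTorus
-- Assembly of the theorem
open LerayTorus in
theorem theorem5p1 (d : ℕ) (hd : 2 ≤ d) (Λ : Finset (Fin d → ℤ))
    (hsymm : IsSymmetric Λ) (hnondeg : IsNondegenerate hd Λ)
    (R : Finset (Fin d → ℤ)) (hR : IsRepresentatives Λ R) :
    -- `u` is the two-point function of the ensemble
    (∀ x y : UnitAddTorus (Fin d),
      Integrable (fun Z => randomFunction Λ R Z x * randomFunction Λ R Z y) (gaussianEnsemble R) ∧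
      ∫ Z, randomFunction Λ R Z x * randomFunction Λ R Z y ∂(gaussianEnsemble R) =
        twoPoint Λ (x - y)) ∧
    -- the limit that defines the Leray measure exists almost surely
    (∀ᵐ Z ∂(gaussianEnsemble R), ∃ L : ℝ,
      Tendsto (lerayApprox (randomFunction Λ R Z)) (𝓝[>] 0) (𝓝 L)) ∧
    -- its second moment is finite
    MemLp (fun Z => leray (randomFunction Λ R Z)) 2 (gaussianEnsemble R) ∧
    -- the kernel is integrable
    Integrable (fun z : UnitAddTorus (Fin d) => 1 / Real.sqrt (1 - twoPoint Λ z ^ 2)) volume ∧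
    ∫ Z, leray (randomFunction Λ R Z) ^ 2 ∂(gaussianEnsemble R) =
      1 / (2 * Real.pi) * ∫ z : UnitAddTorus (Fin d), 1 / Real.sqrt (1 - twoPoint Λ z ^ 2) := by
  obtain ⟨hpos, hint⟩ := twoPoint_kernel hd hsymm hnondeg
  have hcard : 0 < Λ.card := Finset.card_pos.2 hsymm.nonempty
  have hRne : R.Nonempty := by
    obtain ⟨l, hl⟩ := hsymm.nonempty
    rcases hR.2 l hl with h | h
    · exact ⟨_, h.1⟩
    · exact ⟨_, h.1⟩
  have hlim := ae_exists_tendsto_lerayApprox (Λ := Λ) hcard hRne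
  -- Only almost sure convergence is needed, so the default value of `limUnder` on the exceptional
  -- null set does not matter.
  have hseq : ∀ᵐ Z ∂(gaussianEnsemble R), Tendsto
      (fun n : ℕ => lerayApprox (randomFunction Λ R Z) (1 / ((n : ℝ) + 1))) atTop
      (𝓝 (leray (randomFunction Λ R Z))) := by
    filter_upwards [hlim] with Z ⟨L, hL⟩
    rw [leray, hL.limUnder_eq]
    exact hL.comp tendsto_one_div_add_nhdsGT
  obtain ⟨hmem, hsq⟩ := memLp_and_integral_sq_of_tendsto
    (fun n : ℕ => memLp_lerayApprox (Λ := Λ) (R := R) (1 / ((n : ℝ) + 1)))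
    (tendsto_integral_lerayApprox_mul hsymm hR hpos hint) hseq
  refine ⟨fun x y => ⟨?_, integral_randomFunction_mul hsymm.neg_mem hR x y⟩, hlim, hmem, hint, hsq⟩
  simp only [randomFunction_eq]
  exact integrable_linearFunctional_mul _ _
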